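/- Let $0<a<b$, $\alpha\in\mathbb R$, $\beta\ge 0$. Put $\gamma_1=(a,b)$, $\gamma_2=(-b,-a)$, both oriented to the right, and $\Gamma=[a,b]\cup[-b,-a]$. Let $R$ be a real-valued even function on $\gamma_1\cup\gamma_2$ (that is, $R(-s)=R(s)$) which is continuous and bounded on $(a,b)$. For real $x,t$ consider the soliton-gas Riemann–Hilbert problem of the Hirota equation $iq_t+\alpha(q_{xx}+2|q|^2q)+i\beta(q_{xxx}+6|q|^2q_x)=0$: find a $2\times2$ matrix function $M(z)=M^{(3)}(x,t;z)$ such that * $M$ is analytic in $\mathbb C\setminus\Gamma$ and takes continuous boundary values $M_+$ (from the upper half plane) and $M_-$ (from the lower half plane) on $\gamma_1\cup\gamma_2$; * $M_+(s)=M_-(s)V(s)$ on $\gamma_1\cup\gamma_2$, where $$V(s)=\begin{pmatrix}1&0\\ iR(s)e^{-2sx-4i\alpha s^2t+8\beta s^3t}&1\end{pmatrix}\ (s\in\gamma_1),\qquad V(s)=\begin{pmatrix}1&iR(s)e^{2sx+4i\alpha s^2t-8\beta s^3t}\\0&1\end{pmatrix}\ (s\in\gamma_2);$$ * $M(z)=\mathbb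 I+O(z^{-1})$ as $z\to\infty$; * $(z-e)M(z)\to0$ as $z\to e$, $z\notin\Gamma$, for each endpoint $e\in\{\pm a,\pm b\}$. The potential is $q(x,t)=-2\lim_{z\to\infty}(zM(z))_{12}$. Write $\xi=x/t$. Then there is a constant $C>0$, independent of $x$, $t$ and $z$, such that the following hold. 1. For all $t>0$ and $\xi>4\beta b^2$, every entry of $V(s)-\mathbb I$ is at most $C e^{-2ta(\xi-4\beta b^2)}$ in modulus, for all $s\in\gamma_1\cup\gamma_2$. 2. For every $\xi_0>4\beta b^2$ there is $T>0$ such that for all $t\ge T$ and all $x$ with $\xi=x/t\ge\xi_0$: (a) the Riemann–Hilbert problem has at most one solution, and it has one if $R$ is moreover Hölder continuous on $(a,b)$ (with some positive exponent); (b) if $M$ is a solution, then for all $z\in\mathbb C\setminus\Gamma$ every entry of $M(z)-\mathbb I$ has modulus at most $$C\Bigl(1+\log^+\frac1{\operatorname{dist}(z,\Gamma)}\Bigr)e^{-2ta(\xi-4\beta b^2)};$$ in particular $M^{(3)}(x,t;z)=\mathbb I+O(e^{-2ta(\xi-4\beta b^2)})$ as $t\to+\infty$, uniformly in $z$ with $\operatorname{dist}(z,\Gamma)\ge\delta$,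 for each $\delta>0$; (c) if $M$ is a solution, then the limit defining $q(x,t)$ exists and $|q(x,t)|\le C e^{-2ta(\xi-4\beta b^2)}$, so that $q(x,t)$ decays to zero exponentially as $t\to+\infty$. -/

import Mathlib

open Filter Topology Set
open scoped Real

noncomputable section

namespace SolitonGas

/-- The closed jump contour `[a, b] ∪ [-b, -a]`, as a subset of the complex plane. -/
def contour (a b : ℝ) : Set ℂ :=
  (fun s : ℝ => (s : ℂ)) '' (Icc a b ∪ Icc (-b) (-a))

/-- The four endpoints of the contour. -/
def endpoints (a b : ℝ) : Set ℂ :=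
  {(a : ℂ), (b : ℂ), -(a : ℂ), -(b : ℂ)}

/-- The jump matrix at the real point `s`: lower triangular on `γ₁ = (a, b)` (where `0 < s`),
upper triangular on `γ₂ = (-b, -a)`. -/
def jumpMatrix (α β : ℝ) (R : ℝ → ℝ) (x t s : ℝ) : Matrix (Fin 2) (Fin 2) ℂ :=
  if 0 < s then
    !![1, 0;
       Complex.I * R s *
         Complex.exp (-2 * s * x - 4 * Complex.I * α * s ^ 2 * t + 8 * β * s ^ 3 * t), 1]
  else
    !![1, Complex.I * R s *
         Complex.exp (2 * s * x + 4 * Complex.I * α * s ^ 2 * t - 8 * β * s ^ 3 * t);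
       0, 1]

/-- `M` solves the soliton-gas Riemann–Hilbert problem of the Hirota equation at `(x, t)`.
Both segments are oriented to the right, so the `+` side is the upper half plane. -/
structure IsSolution (a b α β : ℝ) (R : ℝ → ℝ) (x t : ℝ)
    (M : ℂ → Matrix (Fin 2) (Fin 2) ℂ) : Prop where
  /-- `M` is analytic off the contour. -/
  analytic : ∀ i j, DifferentiableOn ℂ (fun z => M z i j) (contour a b)ᶜ
  /-- `M` takes continuous boundary values from both sides on the open segments, and they are
  related by the jump matrix. -/
  jump : ∃ Mplus Mminus : ℝ → Matrix (Fin 2) (Fin 2) ℂ,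
    ContinuousOn Mplus (Ioo a b ∪ Ioo (-b) (-a)) ∧
    ContinuousOn Mminus (Ioo a b ∪ Ioo (-b) (-a)) ∧
    ∀ s ∈ Ioo a b ∪ Ioo (-b) (-a),
      Tendsto M (𝓝[{z : ℂ | 0 < z.im}] (s : ℂ)) (𝓝 (Mplus s)) ∧
      Tendsto M (𝓝[{z : ℂ | z.im < 0}] (s : ℂ)) (𝓝 (Mminus s)) ∧
      Mplus s = Mminus s * jumpMatrix α β R x t s
  /-- `M(z) = I + O(1/z)` as `z → ∞`. -/
  normalization : ∀ i j,
    (fun z => M z i j - (1 : Matrix (Fin 2) (Fin 2) ℂ) i j)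
      =O[Bornology.cobounded ℂ] fun z => z⁻¹
  /-- The singularities at the endpoints are weaker than poles. -/
  endpoint : ∀ e ∈ endpoints a b,
    Tendsto (fun z => (z - e) • M z) (𝓝[(contour a b)ᶜ] e) (𝓝 0)

/-- `q` is the potential recovered from `M`: `q = -2 lim_{z → ∞} (z M(z))₁₂`. -/
def IsPotential (M : ℂ → Matrix (Fin 2) (Fin 2) ℂ) (q : ℂ) : Prop :=
  Tendsto (fun z => -2 * (z • M z) 0 1) (Bornology.cobounded ℂ) (𝓝 q)

end SolitonGas

end

/-! Write a row of `M` as `(f, g)`, and let `c`, `d` be the off-diagonal entries of the jump on `(a,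
b)` and `(-b, -a)`. By triangularity only `f` jumps across `(a, b)`, by `c g`, and only `g` jumps
across `(-b, -a)`, by `d f`. Hence each of the two functions extends across the cut of the other and
is the Cauchy transform of its own jump plus its value at infinity: f = δ + C_(a,b)[c g], g = δ' +
C_(-b,-a)[d f]. This system is `IsCoupledPair`; it is derived in `IsSolution.exists_isCoupledPair`.

The densities involve `f` and `g` only on the opposite cut, at distance at least `2a` from their
own. So no singular integral operator has to be bounded: sup norms suffice, and if `|c|, |d| ≤ ε`
with `ε (b - a) ≤ 2πa`, the system is a contraction with factor 1/2. This yields the bound 2 for the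
unknowns on the opposite cuts (`IsCoupledPair.norm_le`), uniqueness (`IsCoupledPair.eqOn`) and
solvability by Banach's theorem (`exists_isCoupledPair_of_small`). The size of `ε` comes from the
real part of the exponent (`phase_exponent_le`), and large `t` makes it small enough. Then `M - I`
consists of Cauchy transforms of densities of size at most `2ε`, which are `O(ε)` up to a logarithm
near the cut (`norm_cauchyTransform_le_log`), and `q` is a multiple of the integral of such a
density.

Two points of analysis remain. The Cauchy representation has to follow from boundary limits and `(z
- e) M → 0` alone (`eq_cauchyTransform_of_weak_singularities`, `exists_extension_across_segment`).
Conversely, a solution of the system solves the Riemann–Hilbert problem only if the Cauchy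
transforms have boundary values and mild endpoint singularities; this is where Hölder continuity of
`R` enters (`exists_tendsto_cauchyTransform`, `exists_norm_cauchyTransform_le`). -/

namespace SolitonGas

open Complex MeasureTheory
open scoped Interval

/-! ### Holomorphy across the real axis -/

/-- Painlevé's theorem: a continuous function on an open set which is holomorphic off the real
axis is holomorphic. -/
theorem differentiableOn_of_differentiableOn_diff_real {f : ℂ → ℂ} {U : Set ℂ} (hU : IsOpen U)
    (hc : ContinuousOn f U) (hd : DifferentiableOn ℂ f (U \ {z | z.im = 0})) :
    DifferentiableOn ℂ f U := by
  -- Morera: it suffices that integrals around rectangles in `U` vanish.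
  refine (isConservativeOn_and_continuousOn_iff_isDifferentiableOn hU).1 ⟨?_, hc⟩
  have hopen : IsOpen (U \ {z : ℂ | z.im = 0}) :=
    hU.sdiff (isClosed_eq continuous_im continuous_const)
  -- rectangles that do not cross the real axis
  have key : ∀ z w : ℂ, Rectangle z w ⊆ U → (0 ≤ min z.im w.im ∨ max z.im w.im ≤ 0) →
      (∫ x : ℝ in z.re..w.re, f (x + z.im * I)) - (∫ x : ℝ in z.re..w.re, f (x + w.im * I)) +
      I • (∫ y : ℝ in z.im..w.im, f (w.re + y * I)) -
      I • (∫ y : ℝ in z.im..w.im, f (z.re + y * I)) = 0 := by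
    intro z w hzw h0
    refine integral_boundary_rect_eq_zero_of_continuousOn_of_differentiableOn f z w
      (hc.mono hzw) (hd.mono ?_)
    intro u hu
    rw [mem_reProdIm] at hu
    refine ⟨hzw ?_, ?_⟩
    · exact ⟨Ioo_subset_Icc_self hu.1, Ioo_subset_Icc_self hu.2⟩
    · simp only [mem_ofPred_eq]
      rcases h0 with h0 | h0
      · exact (lt_of_le_of_lt h0 hu.2.1).ne'
      · exact (lt_of_lt_of_le hu.2.2 h0).ne
  intro z w hzw
  rw [← add_eq_zero_iff_eq_neg, wedgeIntegral_add_wedgeIntegral_eq]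
  by_cases h0 : 0 ≤ min z.im w.im ∨ max z.im w.im ≤ 0
  · exact key z w hzw h0
  -- A rectangle crossing the axis is cut along it; the integrals over the cut cancel between the
  -- two halves.
  push Not at h0
  have h0' : (0 : ℝ) ∈ [[z.im, w.im]] := ⟨h0.1.le, h0.2.le⟩
  have hsub1 : [[z.im, 0]] ⊆ [[z.im, w.im]] := uIcc_subset_uIcc left_mem_uIcc h0'
  have hsub2 : [[0, w.im]] ⊆ [[z.im, w.im]] := uIcc_subset_uIcc h0' right_mem_uIcc
  have hR1 : Rectangle z w.re ⊆ U := by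
    refine subset_trans ?_ hzw
    intro u hu
    simp only [Rectangle, mem_reProdIm, ofReal_re, ofReal_im] at hu ⊢
    exact ⟨hu.1, hsub1 hu.2⟩
  have hR2 : Rectangle (z.re : ℂ) w ⊆ U := by
    refine subset_trans ?_ hzw
    intro u hu
    simp only [Rectangle, mem_reProdIm, ofReal_re, ofReal_im] at hu ⊢
    exact ⟨hu.1, hsub2 hu.2⟩
  have h1 := key z w.re hR1 (by simp only [ofReal_im]; grind)
  have h2 := key z.re w hR2 (by simp only [ofReal_im]; grind)
  simp only [ofReal_re, ofReal_im] at h1 h2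
  have hint : ∀ x ∈ [[z.re, w.re]], ∀ y1 ∈ [[z.im, w.im]], ∀ y2 ∈ [[z.im, w.im]],
      IntervalIntegrable (fun y : ℝ => f (x + y * I)) volume y1 y2 := by
    intro x hx y1 hy1 y2 hy2
    refine (hc.comp (by fun_prop) ?_).intervalIntegrable
    intro y hy
    apply hzw
    simp only [Rectangle, mem_reProdIm]
    simpa using ⟨hx, uIcc_subset_uIcc hy1 hy2 hy⟩
  have e1 := intervalIntegral.integral_add_adjacent_intervals
    (hint w.re right_mem_uIcc z.im left_mem_uIcc 0 h0')
    (hint w.re right_mem_uIcc 0 h0' w.im right_mem_uIcc)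
  have e2 := intervalIntegral.integral_add_adjacent_intervals
    (hint z.re left_mem_uIcc z.im left_mem_uIcc 0 h0')
    (hint z.re left_mem_uIcc 0 h0' w.im right_mem_uIcc)
  rw [← e1, ← e2, smul_add, smul_add]
  linear_combination h1 + h2

/-! ### Boundary values on half planes and Cauchy's theorem there -/

theorem isOpen_upper : IsOpen {z : ℂ | 0 < z.im} := isOpen_lt continuous_const continuous_im

theorem isOpen_lower : IsOpen {z : ℂ | z.im < 0} := isOpen_lt continuous_im continuous_const

theorem ofReal_mem_closure_upper (s : ℝ) : (s : ℂ) ∈ closure {z : ℂ | 0 < z.im} := by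
  rw [closure_setOfPred_lt_im]; simp

theorem ofReal_mem_closure_lower (s : ℝ) : (s : ℂ) ∈ closure {z : ℂ | z.im < 0} := by
  rw [closure_setOfPred_im_lt]; simp

/-- The boundary extension to the closed upper half plane is continuous. -/
theorem continuousOn_extendFrom_upper {φ : ℂ → ℂ} {φp : ℝ → ℂ}
    (hd : ContinuousOn φ {z | 0 < z.im})
    (hb : ∀ s : ℝ, Tendsto φ (𝓝[{z | 0 < z.im}] (s : ℂ)) (𝓝 (φp s))) :
    ContinuousOn (extendFrom {z : ℂ | 0 < z.im} φ) {z | 0 ≤ z.im} := by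
  refine continuousOn_extendFrom ?_ ?_
  · rw [closure_setOfPred_lt_im]
  · intro z hz
    rcases (show 0 ≤ z.im from hz).lt_or_eq with h | h
    · exact ⟨φ z, hd z h⟩
    · have : z = ((z.re : ℝ) : ℂ) := Complex.ext (by simp) (by simp [← h])
      rw [this]; exact ⟨_, hb _⟩

theorem continuous_upper_boundary {φ : ℂ → ℂ} {φp : ℝ → ℂ}
    (hd : ContinuousOn φ {z | 0 < z.im})
    (hb : ∀ s : ℝ, Tendsto φ (𝓝[{z | 0 < z.im}] (s : ℂ)) (𝓝 (φp s))) : Continuous φp := by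
  have h := continuousOn_extendFrom_upper hd hb
  have e : φp = fun s : ℝ => extendFrom {z : ℂ | 0 < z.im} φ s := by
    funext s; exact (extendFrom_eq (ofReal_mem_closure_upper s) (hb s)).symm
  rw [e]
  exact h.comp_continuous continuous_ofReal (by simp)

theorem tendsto_neg_lower_upper (s : ℝ) :
    Tendsto (fun z : ℂ => -z) (𝓝[{z | 0 < z.im}] (s : ℂ)) (𝓝[{z | z.im < 0}] ((-s : ℝ) : ℂ)) := by
  refine tendsto_nhdsWithin_iff.2 ⟨?_, ?_⟩
  · rw [ofReal_neg]
    exact (continuous_neg.tendsto (s : ℂ)).mono_left nhdsWithin_le_nhds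
  · filter_upwards [self_mem_nhdsWithin] with z hz
    simpa using hz

theorem continuous_lower_boundary {φ : ℂ → ℂ} {φm : ℝ → ℂ}
    (hd : ContinuousOn φ {z | z.im < 0})
    (hb : ∀ s : ℝ, Tendsto φ (𝓝[{z | z.im < 0}] (s : ℂ)) (𝓝 (φm s))) : Continuous φm := by
  have h := continuous_upper_boundary (φ := fun z => φ (-z)) (φp := fun s => φm (-s))
    (hd.comp continuous_neg.continuousOn (fun z hz => by simpa using hz))
    (fun s => (hb (-s)).comp (tendsto_neg_lower_upper s))
  simpa [Function.comp_def] using h.comp continuous_neg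

/-- Cauchy's theorem on the upper half plane for a function that is `o(1/z)` at infinity. -/
theorem tendsto_integral_upper_boundary_zero {φ : ℂ → ℂ} {φp : ℝ → ℂ}
    (hd : DifferentiableOn ℂ φ {z | 0 < z.im})
    (hb : ∀ s : ℝ, Tendsto φ (𝓝[{z | 0 < z.im}] (s : ℂ)) (𝓝 (φp s)))
    (hinf : Tendsto (fun z => z * φ z) (Bornology.cobounded ℂ ⊓ 𝓟 {z | 0 < z.im}) (𝓝 0)) :
    Tendsto (fun N : ℝ => ∫ s in -N..N, φp s) atTop (𝓝 0) := by
  set ψ := extendFrom {z : ℂ | 0 < z.im} φ with hψ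
  have hψc : ContinuousOn ψ {z | 0 ≤ z.im} := continuousOn_extendFrom_upper hd.continuousOn hb
  have hψr : ∀ s : ℝ, ψ s = φp s := fun s =>
    extendFrom_eq (ofReal_mem_closure_upper s) (hb s)
  have hψu : ∀ z : ℂ, 0 < z.im → ψ z = φ z := fun z hz =>
    extendFrom_eq (subset_closure hz) (hd.continuousOn z hz)
  rw [Metric.tendsto_nhds]
  intro η hη
  -- The three sides of the rectangle off the axis have total length `4N`, and `‖ψ‖ ≤ η / (5N)` on
  -- them: the sum is at most `4η/5 < η`.
  have h1 := (Metric.tendsto_nhds.1 hinf) (η / 5) (by positivity)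
  rw [eventually_inf_principal, (hasBasis_cobounded_norm).eventually_iff] at h1
  obtain ⟨N₀, -, hN₀⟩ := h1
  filter_upwards [eventually_ge_atTop N₀, eventually_gt_atTop 0] with N hN hN0
  have hbd : ∀ z : ℂ, N ≤ ‖z‖ → 0 < z.im → ‖ψ z‖ ≤ η / 5 / N := by
    intro z hz hz0
    have := hN₀ (show z ∈ {x : ℂ | N₀ ≤ ‖x‖} from hN.trans hz) hz0
    rw [dist_zero_right, norm_mul] at this
    rw [hψu z hz0, le_div_iff₀ hN0]
    nlinarith [norm_nonneg (φ z)]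
  have hrect := integral_boundary_rect_eq_zero_of_continuousOn_of_differentiableOn ψ
    (-N : ℂ) (N + N * I) (hψc.mono ?_) ?_
  rotate_left
  · intro z hz
    simp only [mem_reProdIm] at hz
    have := hz.2.1
    simp [hN0.le] at this
    exact this
  · refine DifferentiableOn.congr (hd.mono ?_) (f := φ) ?_
    all_goals
      intro z hz
      simp only [mem_reProdIm] at hz
      have := hz.2.1
      simp [hN0.le] at this
    · exact this
    · exact hψu z this
  simp only [neg_re, ofReal_re, add_re, mul_re, I_re, mul_zero, ofReal_im, I_im, mul_one, sub_self,
    add_zero, neg_im, neg_zero, add_im, mul_im, zero_add, ofReal_zero, zero_mul, hψr,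
    smul_eq_mul] at hrect
  have b1 : ‖∫ x in -N..N, ψ (x + N * I)‖ ≤ η / 5 / N * |N - -N| := by
    refine intervalIntegral.norm_integral_le_of_norm_le_const fun x _ => hbd _ ?_ (by simpa)
    have := abs_im_le_norm (x + N * I)
    simp [abs_of_pos hN0] at this
    simpa using this
  have b2 : ∀ r : ℝ, |r| = N → ‖∫ y in (0:ℝ)..N, ψ (r + y * I)‖ ≤ η / 5 / N * |N - 0| := by
    intro r hr
    refine intervalIntegral.norm_integral_le_of_norm_le_const fun y hy => hbd _ ?_ ?_
    · have := abs_re_le_norm (r + y * I)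
      simp only [add_re, ofReal_re, mul_re, I_re, mul_zero, ofReal_im, I_im, mul_one, sub_self,
        add_zero, hr] at this
      exact this
    · rw [uIoc_of_le hN0.le] at hy
      simpa using hy.1
  have b3 := b2 N (abs_of_pos hN0)
  have b4 := b2 (-N) (by rw [abs_neg, abs_of_pos hN0])
  rw [dist_zero_right]
  have e : ∫ s in -N..N, φp s = (∫ x in -N..N, ψ (x + N * I)) -
      I * (∫ y in (0:ℝ)..N, ψ (N + y * I)) + I * ∫ y in (0:ℝ)..N, ψ ((-N : ℝ) + y * I) := by
    linear_combination hrect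
  rw [e]
  have habs : |N - -N| = 2 * N := by rw [sub_neg_eq_add, abs_of_pos (by linarith)]; ring
  rw [habs] at b1
  rw [sub_zero, abs_of_pos hN0] at b3 b4
  have hx : η / 5 / N * N = η / 5 := by field_simp
  calc _ ≤ ‖∫ x in -N..N, ψ (x + N * I)‖ + ‖I * (∫ y in (0:ℝ)..N, ψ (N + y * I))‖ +
        ‖I * ∫ y in (0:ℝ)..N, ψ ((-N : ℝ) + y * I)‖ :=
        (norm_add_le _ _).trans (add_le_add_left (norm_sub_le _ _) _)
    _ < η := by
      rw [norm_mul, norm_mul, norm_I, one_mul, one_mul]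
      linarith

theorem ofReal_add_I_ne_zero (s : ℝ) : (s : ℂ) + I ≠ 0 := fun h => by
  simpa using congrArg im h

/-- The model of a `c/z` tail: `1/(z + i)` is holomorphic on the closed upper half plane, and
subtracting `c/(z + i)` leaves `o(1/z)`. The real part is odd and integrates to zero; the imaginary
part gives the arctangent. -/
theorem integral_inv_add_I (N : ℝ) :
    ∫ s in -N..N, ((s : ℂ) + I)⁻¹ = -(2 * Real.arctan N : ℝ) * I := by
  have hI : ∀ s : ℝ, ((s : ℂ) + I)⁻¹ =
      ((s * (1 + s ^ 2)⁻¹ : ℝ) : ℂ) - I * (((1 + s ^ 2)⁻¹ : ℝ) : ℂ) := by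
    intro s
    have h1 := ofReal_add_I_ne_zero s
    have h2 : (1 + (s : ℂ) ^ 2) ≠ 0 := by
      have : (1 + s ^ 2 : ℝ) ≠ 0 := by positivity
      exact_mod_cast this
    push_cast
    field_simp
    linear_combination I_sq
  have hc : Continuous fun s : ℝ => (1 + s ^ 2)⁻¹ :=
    (continuous_const.add (continuous_pow 2)).inv₀ fun s => by
      have : (0 : ℝ) < 1 + s ^ 2 := by positivity
      exact this.ne'
  have hodd : ∫ s in -N..N, s * (1 + s ^ 2)⁻¹ = 0 := by
    have h := intervalIntegral.integral_comp_neg (a := -N) (b := N)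
      (fun s : ℝ => s * (1 + s ^ 2)⁻¹)
    simp only [neg_neg, neg_mul, even_two, Even.neg_pow, intervalIntegral.integral_neg] at h
    linarith
  simp_rw [hI]
  rw [intervalIntegral.integral_sub, intervalIntegral.integral_const_mul,
    intervalIntegral.integral_ofReal, intervalIntegral.integral_ofReal, hodd,
    integral_inv_one_add_sq, Real.arctan_neg]
  · push_cast; ring
  · exact (continuous_ofReal.comp (continuous_id.mul hc)).intervalIntegrable _ _
  · exact (continuous_const.mul (continuous_ofReal.comp hc)).intervalIntegrable _ _

theorem add_I_ne_zero_of_upper {z : ℂ} (hz : 0 < z.im) : z + I ≠ 0 := fun h => by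
  have := congrArg im h
  simp at this; linarith

theorem tendsto_div_sub_cobounded (w : ℂ) :
    Tendsto (fun z : ℂ => z / (z - w)) (Bornology.cobounded ℂ) (𝓝 1) := by
  have h : Tendsto (fun z : ℂ => 1 + w * (z - w)⁻¹) (Bornology.cobounded ℂ) (𝓝 (1 + w * 0)) := by
    refine tendsto_const_nhds.add (tendsto_const_nhds.mul ?_)
    refine tendsto_inv₀_cobounded.comp ?_
    simp [sub_eq_add_neg]
  rw [mul_zero, add_zero] at h
  refine h.congr' ?_
  have : ∀ᶠ z in Bornology.cobounded ℂ, z ≠ w := by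
    have : ({w} : Set ℂ)ᶜ ∈ Bornology.cobounded ℂ :=
      Bornology.isBounded_def.1 Bornology.isBounded_singleton
    filter_upwards [this] with z hz using hz
  filter_upwards [this] with z hz
  have : z - w ≠ 0 := sub_ne_zero.2 hz
  field_simp
  ring

/-- Cauchy's theorem on the upper half plane for a function that is `c/z + o(1/z)` at infinity. -/
theorem tendsto_integral_upper_boundary {φ : ℂ → ℂ} {φp : ℝ → ℂ} {c : ℂ}
    (hd : DifferentiableOn ℂ φ {z | 0 < z.im})
    (hb : ∀ s : ℝ, Tendsto φ (𝓝[{z | 0 < z.im}] (s : ℂ)) (𝓝 (φp s)))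
    (hinf : Tendsto (fun z => z * φ z) (Bornology.cobounded ℂ ⊓ 𝓟 {z | 0 < z.im}) (𝓝 c)) :
    Tendsto (fun N : ℝ => ∫ s in -N..N, φp s) atTop (𝓝 (-(π * I * c))) := by
  have hφc := continuous_upper_boundary hd.continuousOn hb
  have hic : Continuous fun s : ℝ => ((s : ℂ) + I)⁻¹ :=
    (continuous_ofReal.add continuous_const).inv₀ ofReal_add_I_ne_zero
  have h := tendsto_integral_upper_boundary_zero (φ := fun z => φ z - c * (z + I)⁻¹)
    (φp := fun s => φp s - c * ((s : ℂ) + I)⁻¹) ?_ ?_ ?_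
  · have harc : Tendsto (fun N : ℝ => c * (-(2 * Real.arctan N : ℝ) * I)) atTop
        (𝓝 (c * (-(2 * (π / 2) : ℝ) * I))) := by
      refine tendsto_const_nhds.mul (Tendsto.mul (Tendsto.neg ?_) tendsto_const_nhds)
      refine (continuous_ofReal.tendsto _).comp ?_
      exact (Real.tendsto_arctan_atTop.mono_right nhdsWithin_le_nhds).const_mul 2
    have h3 := h.add harc
    have e : (0 : ℂ) + c * (-(2 * (π / 2) : ℝ) * I) = -(π * I * c) := by push_cast; ring
    rw [e] at h3
    refine h3.congr fun N => ?_
    rw [intervalIntegral.integral_sub (hφc.intervalIntegrable _ _)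
      ((hic.const_mul c).intervalIntegrable _ _), intervalIntegral.integral_const_mul,
      integral_inv_add_I]
    ring
  · refine hd.sub ((differentiableOn_const c).mul ?_)
    exact (differentiableOn_id.add (differentiableOn_const I)).inv
      fun z hz => add_I_ne_zero_of_upper hz
  · intro s
    refine (hb s).sub (tendsto_const_nhds.mul (Tendsto.inv₀ ?_ (ofReal_add_I_ne_zero s)))
    exact ((continuous_id.add continuous_const).tendsto (s : ℂ)).mono_left nhdsWithin_le_nhds
  · have h1 := ((tendsto_div_sub_cobounded (-I)).const_mul c).mono_left
      (inf_le_left (b := 𝓟 {z : ℂ | 0 < z.im}))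
    have h2 := hinf.sub h1
    rw [mul_one, sub_self] at h2
    refine h2.congr fun z => ?_
    rw [sub_neg_eq_add, div_eq_mul_inv]; ring

/-- Cauchy's theorem on the lower half plane for a function that is `c/z + o(1/z)` at infinity. -/
theorem tendsto_integral_lower_boundary {φ : ℂ → ℂ} {φm : ℝ → ℂ} {c : ℂ}
    (hd : DifferentiableOn ℂ φ {z | z.im < 0})
    (hb : ∀ s : ℝ, Tendsto φ (𝓝[{z | z.im < 0}] (s : ℂ)) (𝓝 (φm s)))
    (hinf : Tendsto (fun z => z * φ z) (Bornology.cobounded ℂ ⊓ 𝓟 {z | z.im < 0}) (𝓝 c)) :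
    Tendsto (fun N : ℝ => ∫ s in -N..N, φm s) atTop (𝓝 (π * I * c)) := by
  -- Reflection `z ↦ -z` swaps the half planes and the sign of the `1/z` coefficient.
  have h := tendsto_integral_upper_boundary (φ := fun z => φ (-z)) (φp := fun s => φm (-s))
    (c := -c) ?_ ?_ ?_
  · have e : -(π * I * -c) = π * I * c := by ring
    rw [e] at h
    refine h.congr fun N => ?_
    rw [intervalIntegral.integral_comp_neg, neg_neg]
  · exact hd.comp (differentiableOn_id.neg) fun z hz => by simpa using hz
  · exact fun s => (hb (-s)).comp (tendsto_neg_lower_upper s)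
  · have h1 : Tendsto (fun z : ℂ => -z) (Bornology.cobounded ℂ ⊓ 𝓟 {z | 0 < z.im})
        (Bornology.cobounded ℂ ⊓ 𝓟 {z | z.im < 0}) := by
      refine tendsto_inf.2 ⟨tendsto_neg_cobounded.mono_left inf_le_left, ?_⟩
      refine tendsto_principal.2 ?_
      refine (eventually_principal.2 ?_).filter_mono inf_le_right
      intro z hz; simpa using hz
    have h2 := (hinf.comp h1).neg
    refine h2.congr fun z => ?_
    simp

/-! ### Recovering a function from its jump -/

/-- The Cauchy transform of a density on the open interval `(A, B)`. -/
noncomputable def cauchyTransform (A B : ℝ) (h : ℝ → ℂ) (z : ℂ) : ℂ :=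
  (2 * π * I)⁻¹ * ∫ s in Ioo A B, h s / (s - z)

theorem upper_subset : {z : ℂ | 0 < z.im} ⊆ {z : ℂ | z.im ≠ 0} := fun _ hz => ne_of_gt hz

theorem lower_subset : {z : ℂ | z.im < 0} ⊆ {z : ℂ | z.im ≠ 0} := fun _ hz => ne_of_lt hz

theorem isOpen_im_ne : IsOpen {z : ℂ | z.im ≠ 0} :=
  isOpen_ne_fun continuous_im continuous_const

theorem ofReal_sub_ne_zero {z : ℂ} (hz : z.im ≠ 0) (s : ℝ) : (s : ℂ) - z ≠ 0 := fun h => by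
  apply hz
  have := congrArg im h
  simpa using this

theorem dslope_of_im_ne {n : ℂ → ℂ} {z : ℂ} (hz : z.im ≠ 0) (s : ℝ) :
    ∀ᶠ w in 𝓝 (s : ℂ), dslope n z w = (n w - n z) / (w - z) := by
  have : ∀ᶠ w in 𝓝 (s : ℂ), w ≠ z := isOpen_ne.mem_nhds (sub_ne_zero.1 (ofReal_sub_ne_zero hz s))
  filter_upwards [this] with w hw
  rw [dslope_of_ne _ hw, slope_def_field]

theorem tendsto_dslope {n : ℂ → ℂ} {z y : ℂ} (hz : z.im ≠ 0) {s : ℝ} {U : Set ℂ}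
    (h : Tendsto n (𝓝[U] (s : ℂ)) (𝓝 y)) :
    Tendsto (dslope n z) (𝓝[U] (s : ℂ)) (𝓝 ((y - n z) / (s - z))) := by
  have h1 : Tendsto (fun w : ℂ => w - z) (𝓝[U] (s : ℂ)) (𝓝 (s - z)) :=
    ((continuous_id.sub continuous_const).tendsto (s : ℂ)).mono_left nhdsWithin_le_nhds
  refine ((h.sub_const (n z)).div h1 (ofReal_sub_ne_zero hz s)).congr' ?_
  filter_upwards [nhdsWithin_le_nhds (dslope_of_im_ne (n := n) hz s)] with w hw
  simp [hw]

/-- With `dslope n z` in place of `n w / (w - z)` the pole at `z` is removed, so Cauchy's integral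
formula reduces to Cauchy's theorem on both half planes, whichever of them contains `z`. -/
theorem differentiableOn_dslope_of_isOpen {n : ℂ → ℂ} {U : Set ℂ} (hU : IsOpen U)
    (hn : DifferentiableOn ℂ n U) (z : ℂ) : DifferentiableOn ℂ (dslope n z) U := by
  by_cases hz : z ∈ U
  · exact (differentiableOn_dslope (hU.mem_nhds hz)).2 hn
  · exact (differentiableOn_dslope_of_notMem hz).2 hn

theorem eventually_ne_cobounded (w : ℂ) : ∀ᶠ z in Bornology.cobounded ℂ, z ≠ w := by
  have : ({w} : Set ℂ)ᶜ ∈ Bornology.cobounded ℂ :=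
    Bornology.isBounded_def.1 Bornology.isBounded_singleton
  filter_upwards [this] with z hz using hz

theorem tendsto_mul_dslope_infty {n : ℂ → ℂ} {l : Filter ℂ} (hl : l ≤ Bornology.cobounded ℂ)
    {c : ℂ} (h : Tendsto n l (𝓝 c)) (z : ℂ) :
    Tendsto (fun w => w * dslope n z w) l (𝓝 (c - n z)) := by
  have h1 := ((tendsto_div_sub_cobounded z).mono_left hl).mul (h.sub_const (n z))
  rw [one_mul] at h1
  refine h1.congr' ?_
  filter_upwards [hl (eventually_ne_cobounded z)] with w hw
  rw [dslope_of_ne _ hw, slope_def_field]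
  ring

/-- A function that is holomorphic off the real axis, has one-sided limits at all real points that
agree off `(A, B)`, and has a limit at infinity, is the Cauchy transform of its jump. -/
theorem eq_cauchyTransform_of_regular {n : ℂ → ℂ} {c : ℂ} {A B : ℝ} {h : ℝ → ℂ}
    (hd : DifferentiableOn ℂ n {z | z.im ≠ 0})
    (hreg : ∀ s : ℝ, s ∉ Ioo A B → ∃ y, Tendsto n (𝓝[{z | z.im ≠ 0}] (s : ℂ)) (𝓝 y))
    (hjump : ∀ s ∈ Ioo A B, ∃ p q, Tendsto n (𝓝[{z | 0 < z.im}] (s : ℂ)) (𝓝 p) ∧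
      Tendsto n (𝓝[{z | z.im < 0}] (s : ℂ)) (𝓝 q) ∧ p - q = h s)
    (hinf : Tendsto n (Bornology.cobounded ℂ ⊓ 𝓟 {z | z.im ≠ 0}) (𝓝 c))
    {z : ℂ} (hz : z.im ≠ 0) : n z = c + cauchyTransform A B h z := by
  have hall : ∀ s : ℝ, ∃ p q, Tendsto n (𝓝[{z | 0 < z.im}] (s : ℂ)) (𝓝 p) ∧
      Tendsto n (𝓝[{z | z.im < 0}] (s : ℂ)) (𝓝 q) ∧ p - q = (Ioo A B).indicator h s := by
    intro s
    by_cases hs : s ∈ Ioo A B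
    · rw [indicator_of_mem hs]; exact hjump s hs
    · obtain ⟨y, hy⟩ := hreg s hs
      refine ⟨y, y, hy.mono_left (nhdsWithin_mono _ upper_subset),
        hy.mono_left (nhdsWithin_mono _ lower_subset), ?_⟩
      rw [indicator_of_notMem hs, sub_self]
  choose np nm hp hm hpm using hall
  have dU := differentiableOn_dslope_of_isOpen isOpen_upper (hd.mono upper_subset) z
  have dL := differentiableOn_dslope_of_isOpen isOpen_lower (hd.mono lower_subset) z
  have bU := fun s : ℝ => tendsto_dslope hz (hp s)
  have bL := fun s : ℝ => tendsto_dslope hz (hm s)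
  have iU := tendsto_integral_upper_boundary dU bU (tendsto_mul_dslope_infty inf_le_left
    (hinf.mono_left (inf_le_inf_left _ (principal_mono.2 upper_subset))) z)
  have iL := tendsto_integral_lower_boundary dL bL (tendsto_mul_dslope_infty inf_le_left
    (hinf.mono_left (inf_le_inf_left _ (principal_mono.2 lower_subset))) z)
  have cU := continuous_upper_boundary dU.continuousOn bU
  have cL := continuous_lower_boundary dL.continuousOn bL
  -- At infinity the difference quotient is `(c - n z)/w`, so the two half planes contribute `-πi (c
  -- - n z)` and `πi (c - n z)`. Their difference is `2πi (n z - c)`, while on the axis only the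
  -- jump over `(A, B)` survives.
  have hsub := iU.sub iL
  have heq : ∀ᶠ N : ℝ in atTop, (∫ s in -N..N, (np s - n z) / (s - z)) -
      ∫ s in -N..N, (nm s - n z) / (s - z) = ∫ s in Ioo A B, h s / (s - z) := by
    filter_upwards [eventually_gt_atTop |A|, eventually_gt_atTop |B|, eventually_gt_atTop 0]
      with N hA hB hN
    rw [← intervalIntegral.integral_sub (cU.intervalIntegrable _ _) (cL.intervalIntegrable _ _)]
    have e : ∀ s : ℝ, (np s - n z) / (s - z) - (nm s - n z) / (s - z) =
        (Ioo A B).indicator (fun s => h s / (s - z)) s := by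
      intro s
      rw [← sub_div, sub_sub_sub_cancel_right, hpm]
      by_cases hs : s ∈ Ioo A B
      · rw [indicator_of_mem hs, indicator_of_mem hs]
      · rw [indicator_of_notMem hs, indicator_of_notMem hs, zero_div]
    simp_rw [e]
    rw [intervalIntegral.integral_of_le (by linarith), setIntegral_indicator measurableSet_Ioo,
      inter_eq_right.2]
    intro s hs
    exact ⟨by linarith [neg_abs_le A, hs.1], by linarith [le_abs_self B, hs.2]⟩
  have hlim := tendsto_nhds_unique (tendsto_const_nhds.congr' (heq.mono fun _ h => h.symm)) hsub
  rw [cauchyTransform, hlim]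
  have hpi : (π : ℂ) ≠ 0 := ofReal_ne_zero.2 Real.pi_ne_zero
  have hI := I_ne_zero
  field_simp
  ring

/-- A function that is holomorphic off the real axis, with boundary values on both sides of
`(A, B)`, continuous across the other real points except for finitely many singularities weaker
than poles, is the Cauchy transform of its jump if that is integrable. -/
theorem eq_cauchyTransform_of_weak_singularities (S : Finset ℝ) {c : ℂ} {A B : ℝ} :
    ∀ {n : ℂ → ℂ} {h : ℝ → ℂ}, DifferentiableOn ℂ n {z | z.im ≠ 0} →
    (∀ s : ℝ, s ∉ Ioo A B → s ∉ S → ∃ y, Tendsto n (𝓝[{z | z.im ≠ 0}] (s : ℂ)) (𝓝 y)) →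
    (∀ e ∈ S, Tendsto (fun w => (w - e) * n w) (𝓝[{z | z.im ≠ 0}] (e : ℂ)) (𝓝 0)) →
    (∀ s ∈ Ioo A B, ∃ p q, Tendsto n (𝓝[{z | 0 < z.im}] (s : ℂ)) (𝓝 p) ∧
      Tendsto n (𝓝[{z | z.im < 0}] (s : ℂ)) (𝓝 q) ∧ p - q = h s) →
    IntegrableOn h (Ioo A B) →
    Tendsto n (Bornology.cobounded ℂ ⊓ 𝓟 {z | z.im ≠ 0}) (𝓝 c) →
    ∀ {z : ℂ}, z.im ≠ 0 → n z = c + cauchyTransform A B h z := by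
  classical
  induction S using Finset.induction_on with
  | empty =>
    intro n h hd hreg _ hjump _ hinf z hz
    exact eq_cauchyTransform_of_regular hd (fun s hs => hreg s hs (by simp)) hjump hinf hz
  | insert e S _ ih =>
    intro n h hd hreg hweak hjump hint hinf z hz
    set p : ℝ → ℂ := fun ε => e + ε * I with hp
    -- Induction removes the singularity at `e`: `nε` is `n(w) (w - e)/(w - p)` with its pole at `p
    -- = e + iε` subtracted. It is regular at `e`, keeps the limit `c` at infinity, and jumps by
    -- `h(s) (s - e)/(s - p)`.
    have hpim : ∀ ε, (p ε).im = ε := fun ε => by simp [hp]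
    set nε : ℝ → ℂ → ℂ := fun ε w => n w + (p ε - e) * dslope n (p ε) w with hnε
    have hform : ∀ ε w, w ≠ p ε →
        nε ε w = ((w - e) * n w - (p ε - e) * n (p ε)) / (w - p ε) := by
      intro ε w hw
      have : w - p ε ≠ 0 := sub_ne_zero.2 hw
      simp only [hnε, dslope_of_ne _ hw, slope_def_field]
      field_simp
      ring
    have hlimW : ∀ (s : ℝ) (U : Set ℂ) (x : ℂ),
        Tendsto (fun w : ℂ => w - x) (𝓝[U] (s : ℂ)) (𝓝 (s - x)) := fun s U x =>
      ((continuous_id.sub continuous_const).tendsto (s : ℂ)).mono_left nhdsWithin_le_nhds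
    have hrep : ∀ ε : ℝ, 0 < ε → nε ε z =
        c + cauchyTransform A B (fun s => h s * ((s - e) / (s - p ε))) z := by
      intro ε hε
      have hne : (p ε).im ≠ 0 := by rw [hpim]; exact hε.ne'
      have hev : ∀ (s : ℝ) (U : Set ℂ), ∀ᶠ w in 𝓝[U] (s : ℂ), w ≠ p ε := fun s U =>
        nhdsWithin_le_nhds (isOpen_ne.mem_nhds (sub_ne_zero.1 (ofReal_sub_ne_zero hne s)))
      refine ih ?_ ?_ ?_ ?_ ?_ ?_ hz
      · exact hd.add ((differentiableOn_const _).mul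
          (differentiableOn_dslope_of_isOpen isOpen_im_ne hd _))
      · intro s hs hsS
        by_cases hse : s = e
        · subst hse
          refine ⟨_, Tendsto.congr' ?_ (((hweak s (Finset.mem_insert_self _ _)).sub_const
            ((p ε - s) * n (p ε))).div (hlimW s _ (p ε)) (ofReal_sub_ne_zero hne s))⟩
          filter_upwards [hev s _] with w hw using (hform ε w hw).symm
        · obtain ⟨y, hy⟩ := hreg s hs (by simp [hse, hsS])
          exact ⟨_, hy.add (tendsto_const_nhds.mul (tendsto_dslope hne hy))⟩
      · intro e' he'
        have h1 := (((hlimW e' {z : ℂ | z.im ≠ 0} e).mul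
          (hweak e' (Finset.mem_insert_of_mem he'))).sub
          ((hlimW e' {z : ℂ | z.im ≠ 0} e').mul_const ((p ε - e) * n (p ε)))).div
            (hlimW e' _ (p ε)) (ofReal_sub_ne_zero hne e')
        simp only [mul_zero, sub_self, zero_mul, zero_div] at h1
        refine h1.congr' ?_
        filter_upwards [hev e' _] with w hw
        rw [hform ε w hw]
        simp only [Pi.div_apply]
        ring
      · intro s hs
        obtain ⟨x, y, hx, hy, hxy⟩ := hjump s hs
        refine ⟨_, _, hx.add (tendsto_const_nhds.mul (tendsto_dslope hne hx)),
          hy.add (tendsto_const_nhds.mul (tendsto_dslope hne hy)), ?_⟩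
        rw [← hxy]
        have := ofReal_sub_ne_zero hne s
        field_simp
        ring
      · refine hint.mul_bdd (c := 1) ?_ ?_
        · refine Continuous.aestronglyMeasurable ?_
          exact (continuous_ofReal.sub continuous_const).div
            (continuous_ofReal.sub continuous_const) (ofReal_sub_ne_zero hne)
        · refine Eventually.of_forall fun s => ?_
          rw [norm_div]
          refine div_le_one_of_le₀ ?_ (norm_nonneg _)
          have := abs_re_le_norm ((s : ℂ) - p ε)
          rw [← ofReal_sub, norm_real]
          simpa [hp] using this
      · have h1 := tendsto_mul_dslope_infty inf_le_left hinf (p ε)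
        have h2 : Tendsto (fun w : ℂ => w⁻¹) (Bornology.cobounded ℂ ⊓ 𝓟 {z : ℂ | z.im ≠ 0}) (𝓝 0) :=
          tendsto_inv₀_cobounded.mono_left inf_le_left
        have h3 := hinf.add ((h2.mul h1).const_mul (p ε - e))
        rw [zero_mul, mul_zero, add_zero] at h3
        refine h3.congr' ?_
        filter_upwards [(eventually_ne_cobounded 0).filter_mono inf_le_left] with w hw
        simp only [hnε]
        field_simp
    have hpl : Tendsto p (𝓝[>] 0) (𝓝[{z : ℂ | z.im ≠ 0}] (e : ℂ)) := by
      refine tendsto_nhdsWithin_iff.2 ⟨?_, ?_⟩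
      · have : Continuous p := by fun_prop
        simpa [hp] using (this.tendsto 0).mono_left nhdsWithin_le_nhds
      · filter_upwards [self_mem_nhdsWithin] with ε hε
        rw [hpim]; exact (ne_of_gt hε)
    have hpl' := hpl.mono_right nhdsWithin_le_nhds
    have hpz : ∀ᶠ ε in 𝓝[>] (0 : ℝ), z ≠ p ε := by
      have : ∀ᶠ ε in 𝓝[>] (0 : ℝ), ε ≠ z.im :=
        nhdsWithin_le_nhds (isOpen_ne.mem_nhds hz.symm)
      filter_upwards [this] with ε h1 h2
      apply h1; rw [h2, hpim]
    -- The subtracted polar part is `(p - e) n(p)/(z - p)`, and `(p - e) n(p) → 0` is exactly the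
    -- weak singularity hypothesis along the vertical approach to `e`.
    have hL : Tendsto (fun ε => nε ε z) (𝓝[>] 0) (𝓝 (n z)) := by
      have hze : z - e ≠ 0 := by
        have := ofReal_sub_ne_zero hz e
        rwa [← neg_sub, neg_ne_zero] at this
      have h1 := ((hweak e (Finset.mem_insert_self _ _)).comp hpl).const_sub ((z - e) * n z) |>.div
        (hpl'.const_sub z) hze
      rw [sub_zero, mul_div_cancel_left₀ _ hze] at h1
      refine h1.congr' ?_
      filter_upwards [hpz] with ε hε
      rw [hform ε z hε]; rfl
    -- Since `p` lies vertically above `e`, `|s - e| ≤ |s - p|`: the extra factor is at most 1 and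
    -- the integrands are dominated by `‖h‖ / |im z|`.
    have hR : Tendsto (fun ε => c + cauchyTransform A B (fun s => h s * ((s - e) / (s - p ε))) z)
        (𝓝[>] 0) (𝓝 (c + cauchyTransform A B h z)) := by
      refine tendsto_const_nhds.add (tendsto_const_nhds.mul ?_)
      refine tendsto_integral_filter_of_dominated_convergence (fun s => ‖h s‖ / |z.im|) ?_ ?_ ?_ ?_
      · filter_upwards [self_mem_nhdsWithin] with ε hε
        have hne : (p ε).im ≠ 0 := by rw [hpim]; exact (ne_of_gt hε)
        refine (hint.aestronglyMeasurable.mul (Continuous.aestronglyMeasurable ?_)).mul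
          (Continuous.aestronglyMeasurable ?_)
        · exact (continuous_ofReal.sub continuous_const).div
            (continuous_ofReal.sub continuous_const) (ofReal_sub_ne_zero hne)
        · exact (continuous_ofReal.sub continuous_const).inv₀ (ofReal_sub_ne_zero hz)
      · filter_upwards [self_mem_nhdsWithin] with ε hε
        refine Eventually.of_forall fun s => ?_
        rw [norm_div, norm_mul]
        have h1 : ‖((s : ℂ) - e) / (s - p ε)‖ ≤ 1 := by
          rw [norm_div]
          refine div_le_one_of_le₀ ?_ (norm_nonneg _)
          have := abs_re_le_norm ((s : ℂ) - p ε)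
          rw [← ofReal_sub, norm_real]
          simpa [hp] using this
        have h2 : |z.im| ≤ ‖(s : ℂ) - z‖ := by
          have := abs_im_le_norm ((s : ℂ) - z)
          simpa using this
        have h3 : 0 < |z.im| := abs_pos.2 hz
        gcongr
        exact mul_le_of_le_one_right (norm_nonneg _) h1
      · exact hint.norm.div_const _
      · have hae : ∀ᵐ s : ℝ ∂(volume.restrict (Ioo A B)), s ≠ e :=
          ae_restrict_of_ae (Measure.ae_ne volume e)
        filter_upwards [hae] with s hs
        have hse : (s : ℂ) - e ≠ 0 := by
          rw [← ofReal_sub]; exact ofReal_ne_zero.2 (sub_ne_zero.2 hs)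
        have h1 := (((tendsto_const_nhds (x := (s : ℂ) - e)).div (hpl'.const_sub (s : ℂ))
          hse).const_mul (h s)).div_const ((s : ℂ) - z)
        rwa [div_self hse, mul_one] at h1
    have hR' := hR.congr' (by filter_upwards [self_mem_nhdsWithin] with ε hε using (hrep ε hε).symm)
    exact tendsto_nhds_unique hL hR'

/-! ### Removing a cut without jump -/

/-- The closed real segment `[A, B]` in the complex plane. -/
def segment (A B : ℝ) : Set ℂ := (fun s : ℝ => (s : ℂ)) '' Icc A B

theorem isCompact_segment (A B : ℝ) : IsCompact (segment A B) :=
  isCompact_Icc.image continuous_ofReal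

theorem isClosed_segment (A B : ℝ) : IsClosed (segment A B) := (isCompact_segment A B).isClosed

theorem ofReal_mem_segment {A B s : ℝ} : (s : ℂ) ∈ segment A B ↔ s ∈ Icc A B := by
  simp [segment]

theorem im_eq_zero_of_mem_segment {A B : ℝ} {z : ℂ} (hz : z ∈ segment A B) : z.im = 0 := by
  obtain ⟨s, -, rfl⟩ := hz; simp

theorem mem_segment_of_im {A B : ℝ} {z : ℂ} (hz : z.im = 0) (h : z.re ∈ Icc A B) :
    z ∈ segment A B := ⟨z.re, h, Complex.ext (by simp) (by simp [hz])⟩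

theorem dense_im_ne : Dense {z : ℂ | z.im ≠ 0} := by
  intro z
  by_cases hz : z.im = 0
  · have : z = ((z.re : ℝ) : ℂ) := Complex.ext (by simp) (by simp [hz])
    rw [this]
    exact closure_mono upper_subset (ofReal_mem_closure_upper _)
  · exact subset_closure hz

theorem nhdsWithin_im_ne (s : ℝ) : 𝓝[{z : ℂ | z.im ≠ 0}] (s : ℂ) =
    𝓝[{z : ℂ | 0 < z.im}] (s : ℂ) ⊔ 𝓝[{z : ℂ | z.im < 0}] (s : ℂ) := by
  rw [← nhdsWithin_union]
  congr 1
  ext z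
  simp only [mem_union, mem_ofPred_eq, ne_iff_lt_or_gt]
  exact or_comm

theorem nhdsWithin_compl_segment {A B s : ℝ} (hs : s ∈ Ioo A B) {U : Set ℂ}
    (hU : U ⊆ (segment A B)ᶜ) : 𝓝[U] (s : ℂ) ≤ 𝓝[{z : ℂ | z.im ≠ 0}] (s : ℂ) := by
  refine le_inf nhdsWithin_le_nhds (le_principal_iff.2 ?_)
  have h : ∀ᶠ z in 𝓝 (s : ℂ), z.re ∈ Ioo A B :=
    (continuous_re.tendsto (s : ℂ)).eventually (isOpen_Ioo.mem_nhds (by simpa using hs))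
  filter_upwards [self_mem_nhdsWithin, nhdsWithin_le_nhds h] with z hz hz' him
  exact hU hz (mem_segment_of_im him (Ioo_subset_Icc_self hz'))

/-- A holomorphic function extends across a segment on whose interior its boundary values from
both sides agree, if its singularities at the endpoints are weaker than poles. -/
theorem exists_extension_across_segment {K : Set ℂ} (hK : IsClosed K) {A B : ℝ} (hAB : A < B)
    (hd : Disjoint K (segment A B)) {f : ℂ → ℂ} (hf : DifferentiableOn ℂ f (K ∪ segment A B)ᶜ)
    (hb : ∀ s ∈ Ioo A B, ∃ v, Tendsto f (𝓝[{z : ℂ | z.im ≠ 0}] (s : ℂ)) (𝓝 v))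
    (hA : Tendsto (fun w => (w - A) * f w) (𝓝[(K ∪ segment A B)ᶜ] (A : ℂ)) (𝓝 0))
    (hB : Tendsto (fun w => (w - B) * f w) (𝓝[(K ∪ segment A B)ᶜ] (B : ℂ)) (𝓝 0)) :
    ∃ F : ℂ → ℂ, DifferentiableOn ℂ F Kᶜ ∧ EqOn f F (K ∪ segment A B)ᶜ := by
  set Ω := (K ∪ segment A B)ᶜ with hΩ
  have hΩo : IsOpen Ω := (hK.union (isClosed_segment A B)).isOpen_compl
  have hcl : Kᶜ ⊆ closure Ω := by
    refine (dense_im_ne.open_subset_closure_inter hK.isOpen_compl).trans (closure_mono ?_)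
    rintro z ⟨h1, h2⟩ (h | h)
    · exact h1 h
    · exact h2 (im_eq_zero_of_mem_segment h)
  -- The factor `(w - A)(w - B)` turns the weak singularities into zeros, so that `n` extends
  -- continuously to the whole segment and the Painlevé theorem applies.
  set n : ℂ → ℂ := fun w => (w - A) * (w - B) * f w with hn
  have hnd : DifferentiableOn ℂ n Ω :=
    ((differentiableOn_id.sub_const _).mul (differentiableOn_id.sub_const _)).mul hf
  have hlin : ∀ (x y : ℂ) (U : Set ℂ), Tendsto (fun w : ℂ => w - y) (𝓝[U] x) (𝓝 (x - y)) :=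
    fun x y U => ((continuous_id.sub continuous_const).tendsto x).mono_left nhdsWithin_le_nhds
  have hnA : Tendsto n (𝓝[Ω] (A : ℂ)) (𝓝 0) := by
    have h := (hlin A B Ω).mul hA
    rw [mul_zero] at h
    exact h.congr fun w => by simp only [hn]; ring
  have hnB : Tendsto n (𝓝[Ω] (B : ℂ)) (𝓝 0) := by
    have h := (hlin B A Ω).mul hB
    rw [mul_zero] at h
    exact h.congr fun w => by simp only [hn]; ring
  have hmem : ∀ s ∈ Icc A B, (s : ℂ) ∈ Kᶜ := fun s hs h =>
    disjoint_left.1 hd h (ofReal_mem_segment.2 hs)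
  have hAc := hmem A (left_mem_Icc.2 hAB.le)
  have hBc := hmem B (right_mem_Icc.2 hAB.le)
  set N := extendFrom Ω n with hN
  have hNΩ : EqOn N n Ω := fun z hz =>
    extendFrom_eq (subset_closure hz) (hnd.continuousOn z hz)
  have hNc : ContinuousOn N Kᶜ := by
    refine continuousOn_extendFrom hcl fun z hz => ?_
    by_cases hzs : z ∈ segment A B
    · obtain ⟨s, hs, rfl⟩ := hzs
      rcases eq_or_lt_of_le hs.1 with h | h1
      · exact ⟨0, h ▸ hnA⟩
      rcases eq_or_lt_of_le hs.2 with h | h2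
      · exact ⟨0, h ▸ hnB⟩
      obtain ⟨v, hv⟩ := hb s ⟨h1, h2⟩
      exact ⟨_, ((hlin s A Ω).mul (hlin s B Ω)).mul (hv.mono_left
        (nhdsWithin_compl_segment ⟨h1, h2⟩ (compl_subset_compl.2 subset_union_right)))⟩
    · have : z ∈ Ω := fun h => h.elim hz hzs
      exact ⟨_, hnd.continuousOn z this⟩
  have hNd : DifferentiableOn ℂ N Kᶜ := by
    refine differentiableOn_of_differentiableOn_diff_real hK.isOpen_compl hNc ?_
    have hsub : Kᶜ \ {z : ℂ | z.im = 0} ⊆ Ω := by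
      rintro z ⟨h1, h2⟩ (h | h)
      · exact h1 h
      · exact h2 (im_eq_zero_of_mem_segment h)
    exact (hnd.mono hsub).congr (hNΩ.mono hsub)
  have hNA : N A = 0 := extendFrom_eq (hcl hAc) hnA
  have hNB : N B = 0 := extendFrom_eq (hcl hBc) hnB
  -- As `N` vanishes at `A` and `B`, this double difference quotient equals `N(w)/((w - A)(w - B))`
  -- away from the endpoints and is holomorphic at them.
  refine ⟨dslope (dslope N A) B, differentiableOn_dslope_of_isOpen hK.isOpen_compl
    (differentiableOn_dslope_of_isOpen hK.isOpen_compl hNd _) _, ?_⟩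
  intro w hw
  have hne : ∀ s ∈ Icc A B, w ≠ (s : ℂ) := by
    rintro s hs rfl
    exact hw (Or.inr (ofReal_mem_segment.2 hs))
  have hwA := hne A (left_mem_Icc.2 hAB.le)
  have hwB := hne B (right_mem_Icc.2 hAB.le)
  have hBA : (B : ℂ) ≠ A := fun h => hAB.ne' (ofReal_injective h)
  rw [dslope_of_ne _ hwB, slope_def_field, dslope_of_ne _ hwA, dslope_of_ne _ hBA,
    slope_def_field, slope_def_field, hNA, hNB, hNΩ hw]
  have h1 := sub_ne_zero.2 hwA
  have h2 := sub_ne_zero.2 hwB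
  simp only [hn]
  field_simp
  simp

/-! ### Cauchy transforms: analyticity, size, behaviour at infinity -/

section CauchyTransform

variable {A B : ℝ} {h : ℝ → ℂ}

theorem ofReal_sub_ne_zero_of_notMem {z : ℂ} (hz : z ∉ segment A B) {s : ℝ} (hs : s ∈ Icc A B) :
    (s : ℂ) - z ≠ 0 := fun h => hz ⟨s, hs, sub_eq_zero.1 h⟩

theorem infDist_segment_le {s : ℝ} (hs : s ∈ Ioo A B) (z : ℂ) :
    Metric.infDist z (segment A B) ≤ ‖(s : ℂ) - z‖ := by
  rw [norm_sub_rev, ← dist_eq_norm]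
  exact Metric.infDist_le_dist_of_mem (ofReal_mem_segment.2 (Ioo_subset_Icc_self hs))

theorem infDist_segment_pos (hAB : A < B) {z : ℂ} (hz : z ∉ segment A B) :
    0 < Metric.infDist z (segment A B) :=
  ((isClosed_segment A B).notMem_iff_infDist_pos
    ⟨A, ofReal_mem_segment.2 (left_mem_Icc.2 hAB.le)⟩).1 hz

theorem aestronglyMeasurable_inv_sub (z : ℂ) {μ : Measure ℝ} :
    AEStronglyMeasurable (fun s : ℝ => ((s : ℂ) - z)⁻¹) μ :=
  (measurable_ofReal.sub_const z).inv.aestronglyMeasurable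

theorem differentiableOn_cauchyTransform (hAB : A < B) (hh : IntegrableOn h (Ioo A B)) :
    DifferentiableOn ℂ (cauchyTransform A B h) (segment A B)ᶜ := by
  refine DifferentiableOn.const_mul ?_ _
  intro z hz
  set r := Metric.infDist z (segment A B) with hr
  have hr0 : 0 < r := infDist_segment_pos hAB hz
  have hlow : ∀ x ∈ Metric.ball z (r / 2), ∀ s ∈ Ioo A B, r / 2 ≤ ‖(s : ℂ) - x‖ := by
    intro x hx s hs
    have h1 := infDist_segment_le hs z
    have h2 : ‖(s : ℂ) - z‖ ≤ ‖(s : ℂ) - x‖ + ‖x - z‖ := by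
      simpa using norm_add_le ((s : ℂ) - x) (x - z)
    rw [Metric.mem_ball, dist_eq_norm] at hx
    linarith
  have key := hasDerivAt_integral_of_dominated_loc_of_deriv_le
    (μ := volume.restrict (Ioo A B)) (F := fun x s => h s / (s - x))
    (F' := fun x s => h s / (s - x) ^ 2) (x₀ := z) (bound := fun s => ‖h s‖ / (r / 2) ^ 2)
    (Metric.ball_mem_nhds z (half_pos hr0)) ?_ ?_ ?_ ?_ ?_ ?_
  · exact key.2.differentiableAt.differentiableWithinAt
  · exact Eventually.of_forall fun x =>
      hh.aestronglyMeasurable.mul (aestronglyMeasurable_inv_sub x)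
  · refine Integrable.mono (hh.norm.div_const (r / 2))
      (hh.aestronglyMeasurable.mul (aestronglyMeasurable_inv_sub z)) ?_
    filter_upwards [ae_restrict_mem measurableSet_Ioo] with s hs
    have := hlow z (Metric.mem_ball_self (half_pos hr0)) s hs
    rw [norm_div, norm_div, norm_norm, Real.norm_of_nonneg (half_pos hr0).le]
    gcongr
  · refine hh.aestronglyMeasurable.mul
      (((measurable_ofReal.sub_const z).pow_const 2).inv.aestronglyMeasurable)
  · filter_upwards [ae_restrict_mem measurableSet_Ioo] with s hs x hx
    have := hlow x hx s hs
    rw [norm_div, norm_pow]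
    gcongr
  · exact hh.norm.div_const _
  · filter_upwards [ae_restrict_mem measurableSet_Ioo] with s hs x hx
    have h1 := hlow x hx s hs
    have h2 : (s : ℂ) - x ≠ 0 := norm_pos_iff.1 ((half_pos hr0).trans_le h1)
    have h3 := (((hasDerivAt_id x).const_sub (s : ℂ)).inv h2).const_mul (h s)
    simpa [div_eq_mul_inv] using h3

theorem norm_cauchyTransform_le {K : ℝ} (hK : ∀ s ∈ Ioo A B, ‖h s‖ ≤ K) {z : ℂ} {g : ℝ → ℝ}
    (hg : ∀ s ∈ Ioo A B, ‖(s : ℂ) - z‖⁻¹ ≤ g s) (hgi : IntegrableOn g (Ioo A B)) :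
    ‖cauchyTransform A B h z‖ ≤ K / (2 * π) * ∫ s in Ioo A B, g s := by
  have h1 : ‖∫ s in Ioo A B, h s / (s - z)‖ ≤ ∫ s in Ioo A B, K * g s := by
    refine norm_integral_le_of_norm_le (hgi.const_mul K) ?_
    filter_upwards [ae_restrict_mem measurableSet_Ioo] with s hs
    rw [norm_div, div_eq_mul_inv]
    exact mul_le_mul (hK s hs) (hg s hs) (by positivity) ((norm_nonneg _).trans (hK s hs))
  rw [integral_const_mul] at h1
  have h2 : ‖(2 * π * I : ℂ)⁻¹‖ = (2 * π)⁻¹ := by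
    simp [abs_of_pos Real.pi_pos]
  rw [cauchyTransform, norm_mul, h2]
  calc _ ≤ (2 * π)⁻¹ * (K * ∫ s in Ioo A B, g s) := by gcongr
    _ = _ := by ring

theorem norm_cauchyTransform_le_of_dist (hAB : A < B) {K δ : ℝ} (hδ : 0 < δ)
    (hK : ∀ s ∈ Ioo A B, ‖h s‖ ≤ K) {z : ℂ} (hz : ∀ s ∈ Ioo A B, δ ≤ ‖(s : ℂ) - z‖) :
    ‖cauchyTransform A B h z‖ ≤ K / (2 * π) * ((B - A) / δ) := by
  have := norm_cauchyTransform_le hK (g := fun _ => δ⁻¹)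
    (fun s hs => inv_anti₀ hδ (hz s hs)) (by simp [integrableOn_const_iff])
  simpa [hAB.le, div_eq_mul_inv] using this

/-- The integrand majorizes the Cauchy kernel in the logarithmic bound, with `u` the distance along
the axis to the point of the cut nearest to `re z`. -/
theorem integral_two_div_add_abs {d l : ℝ} (hd : 0 < d) (hl : 0 ≤ l) :
    ∫ u in -l..l, 2 / (d + |u|) = 4 * Real.log ((d + l) / d) := by
  have hc : Continuous fun u : ℝ => 2 / (d + |u|) :=
    continuous_const.div (by fun_prop) fun u => by positivity
  have hpos : ∫ u in (0:ℝ)..l, 2 / (d + |u|) = 2 * Real.log ((d + l) / d) := by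
    have e : ∫ u in (0:ℝ)..l, 2 / (d + |u|) = ∫ u in (0:ℝ)..l, 2 * (d + u)⁻¹ := by
      refine intervalIntegral.integral_congr fun u hu => ?_
      rw [uIcc_of_le hl] at hu
      simp only [abs_of_nonneg hu.1, div_eq_mul_inv]
    rw [e, intervalIntegral.integral_const_mul,
      intervalIntegral.integral_comp_add_left (fun u => u⁻¹), add_zero,
      integral_inv_of_pos hd (by linarith)]
  have hneg : ∫ u in -l..0, 2 / (d + |u|) = ∫ u in (0:ℝ)..l, 2 / (d + |u|) := by
    have := intervalIntegral.integral_comp_neg (a := 0) (b := l) (fun u => 2 / (d + |u|))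
    simpa using this.symm
  rw [← intervalIntegral.integral_add_adjacent_intervals (hc.intervalIntegrable _ 0)
    (hc.intervalIntegrable _ _), hneg, hpos]
  ring

/-- The logarithmic bound of a Cauchy transform near its cut. -/
theorem norm_cauchyTransform_le_log (hAB : A < B) {K : ℝ} (hK0 : 0 ≤ K)
    (hK : ∀ s ∈ Ioo A B, ‖h s‖ ≤ K) {z : ℂ} {d : ℝ} (hd : 0 < d)
    (hz : ∀ s ∈ Ioo A B, d ≤ ‖(s : ℂ) - z‖) :
    ‖cauchyTransform A B h z‖ ≤
      K * ((1 + Real.posLog (B - A)) * (1 + Real.posLog (1 / d))) := by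
  -- `p` is the projection of `re z` to `[A, B]`. Both `d` and `|s - p|` are at most `‖s - z‖`,
  -- hence so is their mean; this gives the kernel bound `2/(d + |s - p|)`.
  set p := max A (min z.re B) with hp
  have hpm : p ∈ Icc A B := ⟨le_max_left _ _, max_le hAB.le (min_le_right _ _)⟩
  have hpz : ∀ s ∈ Ioo A B, |s - p| ≤ ‖(s : ℂ) - z‖ := by
    intro s hs
    have h1 : |s - z.re| ≤ ‖(s : ℂ) - z‖ := by
      simpa using abs_re_le_norm ((s : ℂ) - z)
    refine le_trans ?_ h1
    obtain ⟨h1, h2⟩ := hs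
    rw [hp, abs_le]
    rcases le_total z.re B with hB | hB
    · rw [min_eq_left hB]
      rcases le_total A z.re with hA | hA
      · rw [max_eq_right hA]
        exact ⟨neg_abs_le _, le_abs_self _⟩
      · rw [max_eq_left hA, abs_of_nonneg (by linarith)]
        constructor <;> linarith
    · rw [min_eq_right hB, max_eq_right hAB.le, abs_of_nonpos (by linarith)]
      constructor <;> linarith
  have hc : Continuous fun s : ℝ => 2 / (d + |s - p|) :=
    continuous_const.div (by fun_prop) fun u => by positivity
  have h1 := norm_cauchyTransform_le hK (z := z) (g := fun s => 2 / (d + |s - p|))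
    (fun s hs => by
      have e1 := hz s hs
      have e2 := hpz s hs
      have : 0 < d + |s - p| := by positivity
      rw [← inv_div]
      exact inv_anti₀ (by positivity) (by linarith))
    (hc.integrableOn_Ioc.mono_set Ioo_subset_Ioc_self)
  -- The interval is enlarged to the one centred at `p` with half-length `B - A`, which contains
  -- `(A, B)` wherever `p` lies.
  have h2 : ∫ s in Ioo A B, 2 / (d + |s - p|) ≤ 4 * Real.log ((d + (B - A)) / d) := by
    rw [← integral_two_div_add_abs hd (by linarith : 0 ≤ B - A)]
    have e := intervalIntegral.integral_comp_sub_right (a := p - (B - A)) (b := p + (B - A))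
      (fun u => 2 / (d + |u|)) p
    rw [sub_sub_cancel_left, add_sub_cancel_left] at e
    rw [← e, intervalIntegral.integral_of_le (by linarith)]
    refine setIntegral_mono_set hc.integrableOn_Ioc ?_ ?_
    · exact Eventually.of_forall fun s => by positivity
    · refine Eventually.of_forall fun s hs => ?_
      exact ⟨by linarith [hs.1, hpm.2], by linarith [hs.2, hpm.1]⟩
  have h3 : Real.log ((d + (B - A)) / d) ≤
      Real.log 2 + Real.posLog (B - A) + Real.posLog (1 / d) := by
    have e : (d + (B - A)) / d = 1 + (B - A) * (1 / d) := by field_simp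
    rw [e]
    calc _ ≤ Real.posLog (1 + (B - A) * (1 / d)) := le_max_right _ _
      _ ≤ Real.log 2 + Real.posLog 1 + Real.posLog ((B - A) * (1 / d)) := Real.posLog_add
      _ ≤ Real.log 2 + 0 + (Real.posLog (B - A) + Real.posLog (1 / d)) := by
        gcongr
        · simp
        · exact Real.posLog_mul
      _ = _ := by ring
  have h4 : Real.log 2 ≤ 1 := by linarith [Real.log_two_lt_d9]
  have h5 := Real.posLog_nonneg (x := B - A)
  have h6 := Real.posLog_nonneg (x := 1 / d)
  have h7 : K / (2 * π) ≤ K / 4 := by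
    gcongr
    linarith [Real.two_le_pi]
  have h8 : 0 ≤ ∫ s in Ioo A B, 2 / (d + |s - p|) := integral_nonneg fun s => by positivity
  calc _ ≤ K / (2 * π) * ∫ s in Ioo A B, 2 / (d + |s - p|) := h1
    _ ≤ K / 4 * (4 * Real.log ((d + (B - A)) / d)) := by gcongr
    _ = K * Real.log ((d + (B - A)) / d) := by ring
    _ ≤ _ := by
      gcongr
      nlinarith

/-- Dominated convergence: `z/(s - z)` tends to `-1` and is bounded by 2 once `‖z‖ ≥ 2|s|`. The
potential is read off from this limit. -/
theorem tendsto_mul_cauchyTransform (hh : IntegrableOn h (Ioo A B)) :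
    Tendsto (fun z => z * cauchyTransform A B h z) (Bornology.cobounded ℂ)
      (𝓝 (-(2 * π * I)⁻¹ * ∫ s in Ioo A B, h s)) := by
  have key : Tendsto (fun z : ℂ => ∫ s in Ioo A B, h s * (z / (s - z))) (Bornology.cobounded ℂ)
      (𝓝 (∫ s in Ioo A B, h s * (-1))) := by
    have : (Bornology.cobounded ℂ).IsCountablyGenerated := by
      rw [← comap_norm_atTop]; infer_instance
    refine tendsto_integral_filter_of_dominated_convergence (fun s => ‖h s‖ * 2) ?_ ?_ ?_ ?_
    · exact Eventually.of_forall fun z => hh.aestronglyMeasurable.mul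
        ((aestronglyMeasurable_inv_sub z).const_mul z)
    · have : ∀ᶠ z in Bornology.cobounded ℂ, 2 * (|A| + |B|) + 1 ≤ ‖z‖ :=
        tendsto_norm_cobounded_atTop.eventually_ge_atTop _
      filter_upwards [this] with z hz
      filter_upwards [ae_restrict_mem measurableSet_Ioo] with s hs
      rw [norm_mul]
      gcongr
      have h1 : ‖(s : ℂ)‖ ≤ |A| + |B| := by
        rw [norm_real, Real.norm_eq_abs, abs_le]
        constructor <;>
          linarith [neg_abs_le A, le_abs_self B, abs_nonneg A, abs_nonneg B, hs.1, hs.2]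
      have h2 : ‖z‖ - ‖(s : ℂ)‖ ≤ ‖(s : ℂ) - z‖ := by
        rw [norm_sub_rev]; exact norm_sub_norm_le _ _
      have h3 : 0 ≤ |A| + |B| := by positivity
      rw [norm_div, div_le_iff₀ (by linarith)]
      linarith
    · exact hh.norm.mul_const 2
    · refine Eventually.of_forall fun s => ?_
      have h1 := ((tendsto_div_sub_cobounded (s : ℂ)).neg).const_mul (h s)
      refine h1.congr fun z => ?_
      rw [← div_neg, neg_sub]
  have h2 := key.const_mul (2 * π * I)⁻¹
  have e : (2 * π * I : ℂ)⁻¹ * ∫ s in Ioo A B, h s * (-1) =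
      -(2 * π * I)⁻¹ * ∫ s in Ioo A B, h s := by
    rw [integral_mul_const]; ring
  rw [e] at h2
  refine h2.congr fun z => ?_
  rw [cauchyTransform, mul_left_comm]
  congr 1
  rw [← integral_const_mul]
  congr 1
  funext s
  ring

theorem cauchyTransform_isBigO (hh : IntegrableOn h (Ioo A B)) :
    cauchyTransform A B h =O[Bornology.cobounded ℂ] fun z => z⁻¹ := by
  have h1 := (tendsto_mul_cauchyTransform hh).isBigO_one ℂ
  have h2 := (Asymptotics.isBigO_refl (fun z : ℂ => z⁻¹) (Bornology.cobounded ℂ)).mul h1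
  simp only [mul_one] at h2
  refine h2.congr' ?_ EventuallyEq.rfl
  filter_upwards [eventually_ne_cobounded 0] with z hz
  field_simp

end CauchyTransform

/-! ### From the Riemann–Hilbert problem to coupled integral equations -/

theorem im_ne_subset_compl_segment (A B : ℝ) : {z : ℂ | z.im ≠ 0} ⊆ (segment A B)ᶜ :=
  fun _ hz h => hz (im_eq_zero_of_mem_segment h)

theorem eqOn_of_eqOn_im_ne {U : Set ℂ} (hU : IsOpen U) {f g : ℂ → ℂ}
    (h : ∀ z ∈ U, z.im ≠ 0 → f z = g z) (hf : ContinuousOn f U) (hg : ContinuousOn g U) :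
    EqOn f g U :=
  EqOn.of_subset_closure (s := U ∩ {z | z.im ≠ 0}) (fun z hz => h z hz.1 hz.2) hf hg
    inter_subset_left (dense_im_ne.open_subset_closure_inter hU)

/-- If `f` jumps by `c * g` across `(A, B)`, where `g` does not jump, and `f` does not jump across
`(A', B')`, then `g` extends across `(A, B)` and `f` is the Cauchy transform of its jump. -/
theorem exists_extension_and_eq_cauchyTransform {A B A' B' : ℝ} (hAB : A < B)
    (hdisj : Disjoint (segment A' B') (segment A B)) {f g : ℂ → ℂ} {c : ℝ → ℂ} {δ : ℂ} {K : ℝ}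
    (hf : DifferentiableOn ℂ f (segment A' B' ∪ segment A B)ᶜ)
    (hg : DifferentiableOn ℂ g (segment A' B' ∪ segment A B)ᶜ)
    (wf : ∀ e ∈ ({A, B, A', B'} : Finset ℝ), Tendsto (fun w => (w - e) * f w)
      (𝓝[(segment A' B' ∪ segment A B)ᶜ] (e : ℂ)) (𝓝 0))
    (wg : ∀ e ∈ ({A, B, A', B'} : Finset ℝ), Tendsto (fun w => (w - e) * g w)
      (𝓝[(segment A' B' ∪ segment A B)ᶜ] (e : ℂ)) (𝓝 0))
    (hinf : Tendsto f (Bornology.cobounded ℂ) (𝓝 δ))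
    (hj : ∀ s ∈ Ioo A B, ∃ p q v, Tendsto f (𝓝[{z | 0 < z.im}] (s : ℂ)) (𝓝 p) ∧
      Tendsto f (𝓝[{z | z.im < 0}] (s : ℂ)) (𝓝 q) ∧
      Tendsto g (𝓝[{z | z.im ≠ 0}] (s : ℂ)) (𝓝 v) ∧ p - q = c s * v)
    (hj' : ∀ s ∈ Ioo A' B', ∃ v, Tendsto f (𝓝[{z | z.im ≠ 0}] (s : ℂ)) (𝓝 v))
    (hc : ContinuousOn c (Ioo A B)) (hK : ∀ s ∈ Ioo A B, ‖c s‖ ≤ K) :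
    ∃ G : ℂ → ℂ, DifferentiableOn ℂ G (segment A' B')ᶜ ∧
      EqOn g G (segment A' B' ∪ segment A B)ᶜ ∧
      IntegrableOn (fun s : ℝ => c s * G s) (Ioo A B) ∧
      EqOn f (fun z => δ + cauchyTransform A B (fun s : ℝ => c s * G s) z)
        (segment A' B' ∪ segment A B)ᶜ := by
  obtain ⟨G, hGd, hgG⟩ := exists_extension_across_segment (isClosed_segment A' B') hAB hdisj hg
    (fun s hs => by obtain ⟨_, _, v, _, _, hv, _⟩ := hj s hs; exact ⟨v, hv⟩)
    (wg A (by simp)) (wg B (by simp))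
  have hsub : segment A B ⊆ (segment A' B')ᶜ := fun z hz h => disjoint_left.1 hdisj h hz
  have hGc : ContinuousOn (fun s : ℝ => G s) (Icc A B) :=
    hGd.continuousOn.comp continuous_ofReal.continuousOn
      fun s hs => hsub (ofReal_mem_segment.2 hs)
  have himsub : {z : ℂ | z.im ≠ 0} ⊆ (segment A' B' ∪ segment A B)ᶜ := by
    rintro z hz (h | h) <;> exact hz (im_eq_zero_of_mem_segment h)
  obtain ⟨KG, hKG⟩ := isCompact_Icc.exists_bound_of_continuousOn hGc
  have hint : IntegrableOn (fun s : ℝ => c s * G s) (Ioo A B) := by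
    have hm : AEStronglyMeasurable (fun s : ℝ => c s * G s) (volume.restrict (Ioo A B)) :=
      (hc.mul (hGc.mono Ioo_subset_Icc_self)).aestronglyMeasurable measurableSet_Ioo
    refine IntegrableOn.of_bound (by simp) hm (K * KG) ?_
    filter_upwards [ae_restrict_mem measurableSet_Ioo] with s hs
    rw [norm_mul]
    exact mul_le_mul (hK s hs) (hKG s (Ioo_subset_Icc_self hs)) (norm_nonneg _)
      ((norm_nonneg _).trans (hK s hs))
  refine ⟨G, hGd, hgG, hint, ?_⟩
  have hopen : IsOpen (segment A' B' ∪ segment A B)ᶜ :=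
    ((isClosed_segment A' B').union (isClosed_segment A B)).isOpen_compl
  -- Off the real axis the representation by the jump applies, with all four endpoints as weak
  -- singularities; density of the nonreal points does the rest.
  refine eqOn_of_eqOn_im_ne hopen ?_ hf.continuousOn ?_
  · intro z _ hz
    refine eq_cauchyTransform_of_weak_singularities {A, B, A', B'} (hf.mono himsub) ?_ ?_ ?_ hint
      (hinf.mono_left inf_le_left) hz
    · intro s hs hsS
      simp only [Finset.mem_insert, Finset.mem_singleton, not_or] at hsS
      by_cases hs' : s ∈ Ioo A' B'
      · exact hj' s hs'
      · have hsΩ : (s : ℂ) ∈ (segment A' B' ∪ segment A B)ᶜ := by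
          rintro (h | h)
          · have h := ofReal_mem_segment.1 h
            exact hs' ⟨lt_of_le_of_ne h.1 (Ne.symm hsS.2.2.1), lt_of_le_of_ne h.2 hsS.2.2.2⟩
          · have h := ofReal_mem_segment.1 h
            exact hs ⟨lt_of_le_of_ne h.1 (Ne.symm hsS.1), lt_of_le_of_ne h.2 hsS.2.1⟩
        exact ⟨_, (hf.continuousOn.continuousAt (hopen.mem_nhds hsΩ)).tendsto.mono_left
          nhdsWithin_le_nhds⟩
    · exact fun e he => (wf e he).mono_left (nhdsWithin_mono _ himsub)
    · intro s hs
      obtain ⟨p, q, v, hp, hq, hv, hpq⟩ := hj s hs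
      refine ⟨p, q, hp, hq, ?_⟩
      have hsG : (s : ℂ) ∈ (segment A' B')ᶜ :=
        hsub (ofReal_mem_segment.2 (Ioo_subset_Icc_self hs))
      have h1 : Tendsto G (𝓝[{z | z.im ≠ 0}] (s : ℂ)) (𝓝 (G s)) :=
        (hGd.continuousOn.continuousAt
          ((isClosed_segment A' B').isOpen_compl.mem_nhds hsG)).tendsto.mono_left
            nhdsWithin_le_nhds
      have h2 : Tendsto G (𝓝[{z | z.im ≠ 0}] (s : ℂ)) (𝓝 v) :=
        hv.congr' (by filter_upwards [self_mem_nhdsWithin] with z hz using hgG (himsub hz))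
      have : (𝓝[{z : ℂ | z.im ≠ 0}] (s : ℂ)).NeBot := mem_closure_iff_nhdsWithin_neBot.1
        (dense_im_ne s)
      rw [hpq, tendsto_nhds_unique h2 h1]
  · exact continuousOn_const.add ((differentiableOn_cauchyTransform hAB hint).continuousOn.mono
      (compl_subset_compl.2 subset_union_right))

/-- The pair of integral equations to which a row of the Riemann–Hilbert problem is equivalent. -/
structure IsCoupledPair (a b : ℝ) (c d : ℝ → ℂ) (δ δ' : ℂ) (F G : ℂ → ℂ) : Prop where
  differentiableOn_left : DifferentiableOn ℂ F (segment a b)ᶜ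
  differentiableOn_right : DifferentiableOn ℂ G (segment (-b) (-a))ᶜ
  integrableOn_left : IntegrableOn (fun s : ℝ => c s * G s) (Ioo a b)
  integrableOn_right : IntegrableOn (fun s : ℝ => d s * F s) (Ioo (-b) (-a))
  eq_left : EqOn F (fun z => δ + cauchyTransform a b (fun s : ℝ => c s * G s) z) (segment a b)ᶜ
  eq_right : EqOn G (fun z => δ' + cauchyTransform (-b) (-a) (fun s : ℝ => d s * F s) z)
    (segment (-b) (-a))ᶜ

theorem disjoint_segments {a b : ℝ} (ha : 0 < a) :
    Disjoint (segment (-b) (-a)) (segment a b) := by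
  rw [disjoint_left]
  rintro _ ⟨s, hs, rfl⟩ h
  have := (ofReal_mem_segment.1 h).1
  linarith [hs.2]

theorem contour_eq (a b : ℝ) : contour a b = segment (-b) (-a) ∪ segment a b := by
  rw [contour, image_union, union_comm]; rfl

section Rows

variable {a b α β x t : ℝ} {R : ℝ → ℝ} {M : ℂ → Matrix (Fin 2) (Fin 2) ℂ}

theorem jumpMatrix_of_mem_right (ha : 0 < a) {s : ℝ} (hs : s ∈ Ioo a b) :
    jumpMatrix α β R x t s = !![1, 0; jumpMatrix α β R x t s 1 0, 1] := by
  simp [jumpMatrix, ha.trans hs.1]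

theorem jumpMatrix_of_mem_left (ha : 0 < a) {s : ℝ} (hs : s ∈ Ioo (-b) (-a)) :
    jumpMatrix α β R x t s = !![1, jumpMatrix α β R x t s 0 1; 0, 1] := by
  have : ¬ 0 < s := by linarith [hs.2]
  simp [jumpMatrix, this]

/-- Triangularity decouples the cuts: on `(a, b)` the second column has no jump and the first jumps
by a multiple of it; on `(-b, -a)` the roles are exchanged. One extension lemma, applied twice with
the columns swapped, gives both equations. -/
theorem IsSolution.exists_isCoupledPair (ha : 0 < a) (hab : a < b) {K : ℝ}
    (hc : ContinuousOn (fun s => jumpMatrix α β R x t s 1 0) (Ioo a b))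
    (hd : ContinuousOn (fun s => jumpMatrix α β R x t s 0 1) (Ioo (-b) (-a)))
    (hcK : ∀ s ∈ Ioo a b, ‖jumpMatrix α β R x t s 1 0‖ ≤ K)
    (hdK : ∀ s ∈ Ioo (-b) (-a), ‖jumpMatrix α β R x t s 0 1‖ ≤ K)
    (hM : IsSolution a b α β R x t M) (i : Fin 2) :
    ∃ F G : ℂ → ℂ, IsCoupledPair a b (fun s => jumpMatrix α β R x t s 1 0)
      (fun s => jumpMatrix α β R x t s 0 1) ((1 : Matrix (Fin 2) (Fin 2) ℂ) i 0)
      ((1 : Matrix (Fin 2) (Fin 2) ℂ) i 1) F G ∧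
      EqOn (fun z => M z i 0) F (contour a b)ᶜ ∧ EqOn (fun z => M z i 1) G (contour a b)ᶜ := by
  have hnab : -b < -a := neg_lt_neg hab
  have hdisj := disjoint_segments (b := b) ha
  obtain ⟨Mp, Mm, -, -, hjump⟩ := hM.jump
  have hweak : ∀ e ∈ ({a, b, -b, -a} : Finset ℝ), ∀ j,
      Tendsto (fun w => (w - e) * M w i j) (𝓝[(contour a b)ᶜ] (e : ℂ)) (𝓝 0) := by
    intro e he j
    have he' : (e : ℂ) ∈ endpoints a b := by
      simp only [Finset.mem_insert, Finset.mem_singleton] at he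
      rcases he with rfl | rfl | rfl | rfl <;> simp [endpoints]
    have h := tendsto_pi_nhds.1 (tendsto_pi_nhds.1 (hM.endpoint _ he') i) j
    simpa using h
  have hinf : ∀ j, Tendsto (fun z => M z i j) (Bornology.cobounded ℂ)
      (𝓝 ((1 : Matrix (Fin 2) (Fin 2) ℂ) i j)) := fun j =>
    tendsto_sub_nhds_zero_iff.1 ((hM.normalization i j).trans_tendsto tendsto_inv₀_cobounded)
  have hup : ∀ s ∈ Ioo a b ∪ Ioo (-b) (-a), ∀ j,
      Tendsto (fun z => M z i j) (𝓝[{z | 0 < z.im}] (s : ℂ)) (𝓝 (Mp s i j)) := fun s hs j =>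
    tendsto_pi_nhds.1 (tendsto_pi_nhds.1 (hjump s hs).1 i) j
  have hlow : ∀ s ∈ Ioo a b ∪ Ioo (-b) (-a), ∀ j,
      Tendsto (fun z => M z i j) (𝓝[{z | z.im < 0}] (s : ℂ)) (𝓝 (Mm s i j)) := fun s hs j =>
    tendsto_pi_nhds.1 (tendsto_pi_nhds.1 (hjump s hs).2.1 i) j
  have j1 : ∀ s ∈ Ioo a b, Mp s i 0 = Mm s i 0 + jumpMatrix α β R x t s 1 0 * Mm s i 1 ∧
      Mp s i 1 = Mm s i 1 := by
    intro s hs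
    have h := (hjump s (Or.inl hs)).2.2
    rw [jumpMatrix_of_mem_right ha hs] at h
    rw [h]
    simp [Matrix.mul_apply, Fin.sum_univ_two, mul_comm]
  have j2 : ∀ s ∈ Ioo (-b) (-a), Mp s i 1 = Mm s i 1 + jumpMatrix α β R x t s 0 1 * Mm s i 0 ∧
      Mp s i 0 = Mm s i 0 := by
    intro s hs
    have h := (hjump s (Or.inr hs)).2.2
    rw [jumpMatrix_of_mem_left ha hs] at h
    rw [h]
    simp [Matrix.mul_apply, Fin.sum_univ_two, mul_comm, add_comm]
  have cont : ∀ s ∈ Ioo a b ∪ Ioo (-b) (-a), ∀ j, Mp s i j = Mm s i j →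
      Tendsto (fun z => M z i j) (𝓝[{z | z.im ≠ 0}] (s : ℂ)) (𝓝 (Mm s i j)) := by
    intro s hs j h
    rw [nhdsWithin_im_ne]
    exact (h ▸ hup s hs j).sup (hlow s hs j)
  have h1 := exists_extension_and_eq_cauchyTransform (f := fun z => M z i 0)
    (g := fun z => M z i 1) (δ := (1 : Matrix (Fin 2) (Fin 2) ℂ) i 0)
    (c := fun s => jumpMatrix α β R x t s 1 0) hab hdisj
    (contour_eq a b ▸ hM.analytic i 0) (contour_eq a b ▸ hM.analytic i 1)
    (fun e he => contour_eq a b ▸ hweak e he 0) (fun e he => contour_eq a b ▸ hweak e he 1)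
    (hinf 0)
    (fun s hs => ⟨_, _, _, hup s (Or.inl hs) 0, hlow s (Or.inl hs) 0,
      cont s (Or.inl hs) 1 (j1 s hs).2, by rw [(j1 s hs).1]; ring⟩)
    (fun s hs => ⟨_, cont s (Or.inr hs) 0 (j2 s hs).2⟩) hc hcK
  have hfin : ∀ e ∈ ({-b, -a, a, b} : Finset ℝ), e ∈ ({a, b, -b, -a} : Finset ℝ) := by
    intro e he
    simp only [Finset.mem_insert, Finset.mem_singleton] at he ⊢
    tauto
  have heq : contour a b = segment a b ∪ segment (-b) (-a) := by rw [contour_eq, union_comm]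
  have h2 := exists_extension_and_eq_cauchyTransform (f := fun z => M z i 1)
    (g := fun z => M z i 0) (δ := (1 : Matrix (Fin 2) (Fin 2) ℂ) i 1)
    (c := fun s => jumpMatrix α β R x t s 0 1) hnab hdisj.symm
    (heq ▸ hM.analytic i 1) (heq ▸ hM.analytic i 0)
    (fun e he => heq ▸ hweak e (hfin e he) 1) (fun e he => heq ▸ hweak e (hfin e he) 0)
    (hinf 1)
    (fun s hs => ⟨_, _, _, hup s (Or.inr hs) 1, hlow s (Or.inr hs) 1,
      cont s (Or.inr hs) 0 (j2 s hs).2, by rw [(j2 s hs).1]; ring⟩)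
    (fun s hs => ⟨_, cont s (Or.inl hs) 1 (j1 s hs).2⟩) hd hdK
  rw [← contour_eq] at h1
  rw [← heq] at h2
  obtain ⟨G, hGd, hgG, hGi, hfG⟩ := h1
  obtain ⟨F, hFd, hfF, hFi, hgF⟩ := h2
  have hsub1 : (contour a b)ᶜ ⊆ (segment a b)ᶜ :=
    compl_subset_compl.2 (contour_eq a b ▸ subset_union_right)
  have hsub2 : (contour a b)ᶜ ⊆ (segment (-b) (-a))ᶜ :=
    compl_subset_compl.2 (contour_eq a b ▸ subset_union_left)
  have him : ∀ z : ℂ, z.im ≠ 0 → z ∈ (contour a b)ᶜ := by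
    intro z hz h
    rw [contour_eq] at h
    exact h.elim (fun h => hz (im_eq_zero_of_mem_segment h))
      (fun h => hz (im_eq_zero_of_mem_segment h))
  refine ⟨F, G, ⟨hFd, hGd, hGi, hFi, ?_, ?_⟩, hfF, hgG⟩
  · refine eqOn_of_eqOn_im_ne (isClosed_segment a b).isOpen_compl ?_ hFd.continuousOn
      (continuousOn_const.add (differentiableOn_cauchyTransform hab hGi).continuousOn)
    intro z _ hz
    rw [← hfF (him z hz), hfG (him z hz)]
  · refine eqOn_of_eqOn_im_ne (isClosed_segment (-b) (-a)).isOpen_compl ?_ hGd.continuousOn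
      (continuousOn_const.add (differentiableOn_cauchyTransform hnab hFi).continuousOn)
    intro z _ hz
    rw [← hgG (him z hz), hgF (him z hz)]

end Rows

/-! ### A priori bound and uniqueness for the coupled equations -/

section Coupled

variable {a b : ℝ} {c d : ℝ → ℂ} {δ δ' : ℂ} {F G : ℂ → ℂ}

theorem two_mul_le_norm_sub (s z : ℝ) {a b : ℝ} (hs : s ∈ Icc a b) (hz : z ∈ Icc (-b) (-a)) :
    2 * a ≤ ‖(s : ℂ) - z‖ := by
  rw [← ofReal_sub, norm_real]
  exact (by linarith [hs.1, hz.2] : 2 * a ≤ s - z).trans (le_abs_self _)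

/-- The source of the smallness condition on `ε`: a Cauchy transform over a segment of length `l`,
seen from distance `2a`, then gains the factor 1/2. -/
theorem mul_div_two_pi_le {a l ε m : ℝ} (ha : 0 < a) (hε : ε * l ≤ 2 * π * a) (hm : 0 ≤ m) :
    ε * m / (2 * π) * (l / (2 * a)) ≤ m / 2 := by
  have hpi := Real.pi_pos
  rw [div_mul_div_comm, div_le_iff₀ (by positivity)]
  nlinarith

/-- Small jumps give a bound by twice the constant terms. -/
theorem IsCoupledPair.norm_le (ha : 0 < a) (hab : a < b) (h : IsCoupledPair a b c d δ δ' F G)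
    {ε η : ℝ} (hε : ε * (b - a) ≤ 2 * π * a)
    (hc : ∀ s ∈ Ioo a b, ‖c s‖ ≤ ε) (hd : ∀ s ∈ Ioo (-b) (-a), ‖d s‖ ≤ ε)
    (hδ : ‖δ‖ ≤ η) (hδ' : ‖δ'‖ ≤ η) :
    (∀ s ∈ Icc (-b) (-a), ‖F s‖ ≤ 2 * η) ∧ ∀ s ∈ Icc a b, ‖G s‖ ≤ 2 * η := by
  have hdisj := disjoint_segments (b := b) ha
  have hsF : ∀ s ∈ Icc (-b) (-a), (s : ℂ) ∈ (segment a b)ᶜ := fun s hs h =>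
    disjoint_left.1 hdisj (ofReal_mem_segment.2 hs) h
  have hsG : ∀ s ∈ Icc a b, (s : ℂ) ∈ (segment (-b) (-a))ᶜ := fun s hs h =>
    disjoint_left.1 hdisj h (ofReal_mem_segment.2 hs)
  have hFc : ContinuousOn (fun s : ℝ => ‖F s‖) (Icc (-b) (-a)) :=
    (h.differentiableOn_left.continuousOn.comp continuous_ofReal.continuousOn hsF).norm
  have hGc : ContinuousOn (fun s : ℝ => ‖G s‖) (Icc a b) :=
    (h.differentiableOn_right.continuousOn.comp continuous_ofReal.continuousOn hsG).norm
  -- Each function is continuous on the cut of the other, so the maxima `X = ‖F u‖`, `Y = ‖G v‖` are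
  -- attained. They satisfy `X ≤ η + Y/2` and `Y ≤ η + X/2`, whence both are at most `2η`.
  obtain ⟨u, hu, hmaxF⟩ := isCompact_Icc.exists_isMaxOn
    (nonempty_Icc.2 (neg_lt_neg hab).le) hFc
  obtain ⟨v, hv, hmaxG⟩ := isCompact_Icc.exists_isMaxOn (nonempty_Icc.2 hab.le) hGc
  have ha2 : 0 < 2 * a := by linarith
  have hε0 : 0 ≤ ε := by
    have hm : (a + b) / 2 ∈ Ioo a b := ⟨by linarith, by linarith⟩
    exact (norm_nonneg _).trans (hc _ hm)
  have e1 : ‖F u‖ ≤ η + ‖G v‖ / 2 := by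
    rw [h.eq_left (hsF u hu)]
    refine (norm_add_le _ _).trans (add_le_add hδ ?_)
    refine (norm_cauchyTransform_le_of_dist hab ha2 (K := ε * ‖G v‖) ?_ ?_).trans
      (mul_div_two_pi_le ha hε (norm_nonneg _))
    · intro s hs
      rw [norm_mul]
      exact mul_le_mul (hc s hs) (hmaxG (Ioo_subset_Icc_self hs)) (norm_nonneg _) hε0
    · exact fun s hs => two_mul_le_norm_sub s u (Ioo_subset_Icc_self hs) hu
  have e2 : ‖G v‖ ≤ η + ‖F u‖ / 2 := by
    rw [h.eq_right (hsG v hv)]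
    refine (norm_add_le _ _).trans (add_le_add hδ' ?_)
    refine (norm_cauchyTransform_le_of_dist (neg_lt_neg hab) ha2 (K := ε * ‖F u‖) ?_ ?_).trans ?_
    · intro s hs
      rw [norm_mul]
      exact mul_le_mul (hd s hs) (hmaxF (Ioo_subset_Icc_self hs)) (norm_nonneg _) hε0
    · intro s hs
      rw [norm_sub_rev]
      exact two_mul_le_norm_sub v s hv (Ioo_subset_Icc_self hs)
    · rw [neg_sub_neg]
      exact mul_div_two_pi_le ha hε (norm_nonneg _)
  exact ⟨fun s hs => (hmaxF hs).trans (by dsimp only; linarith),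
    fun s hs => (hmaxG hs).trans (by dsimp only; linarith)⟩

theorem cauchyTransform_sub {A B : ℝ} {h k : ℝ → ℂ} (hAB : A < B) (hh : IntegrableOn h (Ioo A B))
    (hk : IntegrableOn k (Ioo A B)) {z : ℂ} (hz : z ∉ segment A B) :
    cauchyTransform A B (fun s => h s - k s) z =
      cauchyTransform A B h z - cauchyTransform A B k z := by
  have hr0 := infDist_segment_pos hAB hz
  have hi : ∀ {h : ℝ → ℂ}, IntegrableOn h (Ioo A B) →
      IntegrableOn (fun s : ℝ => h s / (s - z)) (Ioo A B) := by
    intro h hh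
    refine Integrable.mono (hh.norm.div_const (Metric.infDist z (segment A B)))
      (hh.aestronglyMeasurable.mul (aestronglyMeasurable_inv_sub z)) ?_
    filter_upwards [ae_restrict_mem measurableSet_Ioo] with s hs
    have := infDist_segment_le hs z
    rw [norm_div, norm_div, norm_norm, Real.norm_of_nonneg hr0.le]
    gcongr
  rw [cauchyTransform, cauchyTransform, cauchyTransform, ← mul_sub, ← integral_sub (hi hh) (hi hk)]
  simp_rw [sub_div]

theorem cauchyTransform_congr {A B : ℝ} {h k : ℝ → ℂ} (hhk : EqOn h k (Ioo A B)) (z : ℂ) :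
    cauchyTransform A B h z = cauchyTransform A B k z := by
  rw [cauchyTransform, cauchyTransform]
  congr 1
  exact setIntegral_congr_fun measurableSet_Ioo fun s hs => by simp only [hhk hs]

/-- Small jumps determine the pair. -/
theorem IsCoupledPair.eqOn (ha : 0 < a) (hab : a < b) {F' G' : ℂ → ℂ}
    (h : IsCoupledPair a b c d δ δ' F G) (h' : IsCoupledPair a b c d δ δ' F' G')
    {ε : ℝ} (hε : ε * (b - a) ≤ 2 * π * a)
    (hc : ∀ s ∈ Ioo a b, ‖c s‖ ≤ ε) (hd : ∀ s ∈ Ioo (-b) (-a), ‖d s‖ ≤ ε) :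
    EqOn F F' (segment a b)ᶜ ∧ EqOn G G' (segment (-b) (-a))ᶜ := by
  -- The difference solves the homogeneous system, so the bound with `η = 0` kills it on the
  -- opposite cuts. The densities then agree, and with them the functions everywhere.
  have hsub : IsCoupledPair a b c d 0 0 (fun z => F z - F' z) (fun z => G z - G' z) := by
    refine ⟨h.differentiableOn_left.sub h'.differentiableOn_left,
      h.differentiableOn_right.sub h'.differentiableOn_right, ?_, ?_, ?_, ?_⟩
    · simp_rw [mul_sub]; exact h.integrableOn_left.sub h'.integrableOn_left
    · simp_rw [mul_sub]; exact h.integrableOn_right.sub h'.integrableOn_right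
    · intro z hz
      simp_rw [mul_sub]
      rw [cauchyTransform_sub hab h.integrableOn_left h'.integrableOn_left hz, h.eq_left hz,
        h'.eq_left hz]
      ring
    · intro z hz
      simp_rw [mul_sub]
      rw [cauchyTransform_sub (neg_lt_neg hab) h.integrableOn_right h'.integrableOn_right hz,
        h.eq_right hz, h'.eq_right hz]
      ring
  obtain ⟨hF, hG⟩ := hsub.norm_le ha hab hε hc hd (η := 0) (by simp) (by simp)
  simp only [mul_zero, norm_le_zero_iff, sub_eq_zero] at hF hG
  constructor
  · intro z hz
    rw [h.eq_left hz, h'.eq_left hz]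
    dsimp only
    rw [cauchyTransform_congr]
    intro s hs
    simp only [hG s (Ioo_subset_Icc_self hs)]
  · intro z hz
    rw [h.eq_right hz, h'.eq_right hz]
    dsimp only
    rw [cauchyTransform_congr]
    intro s hs
    simp only [hF s (Ioo_subset_Icc_self hs)]

end Coupled

/-! ### Boundary values and endpoint behaviour for Hölder densities -/

/-- For nonreal `z` the path `s - z` stays off the branch cut of the logarithm, so `log (s - z)` is
a primitive. -/
theorem integral_inv_sub_eq_log {A B : ℝ} (hAB : A ≤ B) {z : ℂ} (hz : z.im ≠ 0) :
    ∫ s in Ioo A B, ((s : ℂ) - z)⁻¹ = log (B - z) - log (A - z) := by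
  rw [← integral_Ioc_eq_integral_Ioo, ← intervalIntegral.integral_of_le hAB]
  have hne := ofReal_sub_ne_zero hz
  refine intervalIntegral.integral_eq_sub_of_hasDerivAt (f := fun s : ℝ => log ((s : ℂ) - z)) ?_ ?_
  · intro s _
    have h1 : HasDerivAt (fun w : ℂ => w - z) 1 (s : ℂ) := (hasDerivAt_id _).sub_const z
    have h2 := (h1.clog (Or.inr (by simpa using hz))).comp_ofReal
    simpa using h2
  · exact ((continuous_ofReal.sub continuous_const).inv₀ hne).intervalIntegrable _ _

theorem integrableOn_abs_rpow {r : ℝ} (hr : 0 < r) {l : ℝ} (hl : 0 ≤ l) :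
    IntegrableOn (fun u : ℝ => |u| ^ (r - 1)) (Ioo (-l) l) := by
  have h1 : IntervalIntegrable (fun u : ℝ => |u| ^ (r - 1)) volume 0 l := by
    rw [intervalIntegrable_iff_integrableOn_Ioc_of_le hl]
    have h := (intervalIntegrable_iff_integrableOn_Ioc_of_le hl).1
      (intervalIntegral.intervalIntegrable_rpow' (a := 0) (b := l) (r := r - 1) (by linarith))
    refine h.congr_fun (fun u hu => ?_) measurableSet_Ioc
    simp only [abs_of_pos hu.1]
  have h2 : IntervalIntegrable (fun u : ℝ => |u| ^ (r - 1)) volume (-l) 0 := by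
    have h := (IntervalIntegrable.iff_comp_neg).1 h1
    simp only [abs_neg, neg_zero] at h
    exact h.symm
  exact ((intervalIntegrable_iff_integrableOn_Ioc_of_le (by linarith)).1 (h2.trans h1)).mono_set
    Ioo_subset_Ioc_self

section Holder

variable {A B L r K : ℝ} {h : ℝ → ℂ}

/-- The part of a Cauchy integral that is continuous up to the cut for a Hölder density. -/
noncomputable def reducedIntegral (A B : ℝ) (h : ℝ → ℂ) (z : ℂ) : ℂ :=
  ∫ u : ℝ, (Ioo A B).indicator (fun s : ℝ => (h s - h z.re) / (s - z)) (z.re + u)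

/-- In the variable `u = s - re z` the singular point is `u = 0` for every `z`, so the Hölder
condition gives a single integrable majorant `L |u|^(r-1)` independent of `z`. -/
theorem norm_reducedIntegrand_le (hL : 0 ≤ L)
    (hH : ∀ s ∈ Ioo A B, ∀ s' ∈ Ioo A B, ‖h s - h s'‖ ≤ L * |s - s'| ^ r) {z : ℂ}
    (hz : z.re ∈ Ioo A B) (u : ℝ) :
    ‖(Ioo A B).indicator (fun s : ℝ => (h s - h z.re) / (s - z)) (z.re + u)‖ ≤
      (Ioo (-(B - A)) (B - A)).indicator (fun u => L * |u| ^ (r - 1)) u := by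
  have hnn : 0 ≤ (Ioo (-(B - A)) (B - A)).indicator (fun u => L * |u| ^ (r - 1)) u :=
    indicator_nonneg (fun u _ => by positivity) u
  by_cases hu : z.re + u ∈ Ioo A B
  swap
  · rwa [indicator_of_notMem hu, norm_zero]
  have hu' : u ∈ Ioo (-(B - A)) (B - A) :=
    ⟨by linarith [hu.1, hz.2], by linarith [hu.2, hz.1]⟩
  rw [indicator_of_mem hu, indicator_of_mem hu', norm_div]
  rcases eq_or_ne u 0 with rfl | hu0
  · simp only [add_zero, sub_self, norm_zero, zero_div]
    positivity
  have h1 := hH _ hu _ hz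
  rw [add_sub_cancel_left] at h1
  have h2 : |u| ≤ ‖((z.re + u : ℝ) : ℂ) - z‖ := by
    simpa using abs_re_le_norm (((z.re + u : ℝ) : ℂ) - z)
  have h3 : 0 < |u| := abs_pos.2 hu0
  rw [Real.rpow_sub_one h3.ne', ← mul_div_assoc]
  gcongr

theorem integrable_holder_bound (hr : 0 < r) (hAB : A < B) :
    Integrable ((Ioo (-(B - A)) (B - A)).indicator (fun u => L * |u| ^ (r - 1))) :=
  IntegrableOn.integrable_indicator
    ((integrableOn_abs_rpow hr (sub_nonneg.2 hAB.le)).const_mul L) measurableSet_Ioo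

theorem aestronglyMeasurable_reducedIntegrand (hc : ContinuousOn h (Ioo A B)) (z : ℂ) :
    AEStronglyMeasurable
      (fun u : ℝ => (Ioo A B).indicator (fun s : ℝ => (h s - h z.re) / (s - z)) (z.re + u)) := by
  have h1 : AEStronglyMeasurable
      ((Ioo A B).indicator (fun s : ℝ => (h s - h z.re) / (s - z))) volume := by
    rw [aestronglyMeasurable_indicator_iff measurableSet_Ioo]
    exact ((hc.aestronglyMeasurable measurableSet_Ioo).sub aestronglyMeasurable_const).mul
      (aestronglyMeasurable_inv_sub z)
  exact h1.comp_measurePreserving (measurePreserving_add_left volume z.re)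

theorem norm_reducedIntegral_le (hL : 0 ≤ L) (hr : 0 < r) (hAB : A < B)
    (hH : ∀ s ∈ Ioo A B, ∀ s' ∈ Ioo A B, ‖h s - h s'‖ ≤ L * |s - s'| ^ r) {z : ℂ}
    (hz : z.re ∈ Ioo A B) :
    ‖reducedIntegral A B h z‖ ≤
      ∫ u, (Ioo (-(B - A)) (B - A)).indicator (fun u => L * |u| ^ (r - 1)) u :=
  norm_integral_le_of_norm_le (integrable_holder_bound hr hAB)
    (Eventually.of_forall (norm_reducedIntegrand_le hL hH hz))

/-- The value of the density at `re z` is split off. The remainder is controlled by the Hölder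
condition, and the constant integrates to logarithms, which carry all of the jump and of the
endpoint singularity. -/
theorem cauchyTransform_eq_reducedIntegral (hAB : A < B) (hi : IntegrableOn h (Ioo A B)) {z : ℂ}
    (hz : z.im ≠ 0) :
    cauchyTransform A B h z = (2 * π * I)⁻¹ *
      (reducedIntegral A B h z + h z.re * (log (B - z) - log (A - z))) := by
  have hne := ofReal_sub_ne_zero hz
  have hcinv : Continuous fun s : ℝ => ((s : ℂ) - z)⁻¹ :=
    (continuous_ofReal.sub continuous_const).inv₀ hne
  have hinv : IntegrableOn (fun s : ℝ => ((s : ℂ) - z)⁻¹) (Ioo A B) :=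
    hcinv.integrableOn_Ioc.mono_set Ioo_subset_Ioc_self
  have hbd : ∀ s : ℝ, ‖((s : ℂ) - z)⁻¹‖ ≤ |z.im|⁻¹ := by
    intro s
    rw [norm_inv]
    refine inv_anti₀ (abs_pos.2 hz) ?_
    simpa using abs_im_le_norm ((s : ℂ) - z)
  have h1 : reducedIntegral A B h z = ∫ s in Ioo A B, (h s - h z.re) * ((s : ℂ) - z)⁻¹ := by
    rw [reducedIntegral, integral_add_left_eq_self
      (fun s => (Ioo A B).indicator (fun s : ℝ => (h s - h z.re) / (s - z)) s),
      integral_indicator measurableSet_Ioo]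
    rfl
  have h2 : IntegrableOn (fun s : ℝ => h s * ((s : ℂ) - z)⁻¹) (Ioo A B) :=
    hi.mul_bdd (c := |z.im|⁻¹) hcinv.aestronglyMeasurable (Eventually.of_forall hbd)
  rw [cauchyTransform, h1, ← integral_inv_sub_eq_log hAB.le hz]
  simp_rw [sub_mul]
  rw [integral_sub h2 (hinv.const_mul _), integral_const_mul, sub_add_cancel]
  rfl

theorem tendsto_reducedIntegral (hL : 0 ≤ L) (hr : 0 < r) (hc : ContinuousOn h (Ioo A B))
    (hH : ∀ s ∈ Ioo A B, ∀ s' ∈ Ioo A B, ‖h s - h s'‖ ≤ L * |s - s'| ^ r) {s₀ : ℝ}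
    (hs₀ : s₀ ∈ Ioo A B) :
    Tendsto (reducedIntegral A B h) (𝓝 (s₀ : ℂ)) (𝓝 (reducedIntegral A B h s₀)) := by
  have hAB : A < B := hs₀.1.trans hs₀.2
  have hre : Tendsto (fun z : ℂ => z.re) (𝓝 (s₀ : ℂ)) (𝓝 s₀) := by
    simpa using continuous_re.tendsto (s₀ : ℂ)
  have hcont : ∀ s ∈ Ioo A B, ContinuousAt h s := fun s hs =>
    hc.continuousAt (isOpen_Ioo.mem_nhds hs)
  refine tendsto_integral_filter_of_dominated_convergence
    ((Ioo (-(B - A)) (B - A)).indicator (fun u => L * |u| ^ (r - 1)))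
    (Eventually.of_forall fun z => aestronglyMeasurable_reducedIntegrand hc z) ?_
    (integrable_holder_bound hr hAB) ?_
  · filter_upwards [hre.eventually (isOpen_Ioo.mem_nhds hs₀)] with z hz
    exact Eventually.of_forall (norm_reducedIntegrand_le hL hH hz)
  · filter_upwards [Measure.ae_ne volume (0 : ℝ), Measure.ae_ne volume (A - s₀),
      Measure.ae_ne volume (B - s₀)] with u hu0 huA huB
    have hsh : Tendsto (fun z : ℂ => z.re + u) (𝓝 (s₀ : ℂ)) (𝓝 (s₀ + u)) := hre.add_const u
    rw [ofReal_re]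
    by_cases hu : s₀ + u ∈ Ioo A B
    · rw [indicator_of_mem hu]
      have h1 : Tendsto (fun z : ℂ => (h (z.re + u) - h z.re) / (((z.re + u : ℝ) : ℂ) - z))
          (𝓝 (s₀ : ℂ)) (𝓝 ((h (s₀ + u) - h s₀) / (((s₀ + u : ℝ) : ℂ) - s₀))) := by
        refine Tendsto.div ?_ ?_ ?_
        · exact ((hcont _ hu).tendsto.comp hsh).sub ((hcont _ hs₀).tendsto.comp hre)
        · exact ((continuous_ofReal.tendsto _).comp hsh).sub tendsto_id
        · simpa using hu0
      refine h1.congr' ?_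
      filter_upwards [hsh.eventually (isOpen_Ioo.mem_nhds hu)] with z hz
      rw [indicator_of_mem (s := Ioo A B) hz]
    · have hu' : s₀ + u ∈ (Icc A B)ᶜ := by
        rintro ⟨h1, h2⟩
        refine hu ⟨lt_of_le_of_ne h1 fun h => huA (by linarith),
          lt_of_le_of_ne h2 fun h => huB (by linarith)⟩
      rw [indicator_of_notMem hu]
      refine tendsto_const_nhds.congr' ?_
      filter_upwards [hsh.eventually (isClosed_Icc.isOpen_compl.mem_nhds hu')] with z hz
      rw [indicator_of_notMem fun h => hz (Ioo_subset_Icc_self h)]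

/-- The Sokhotski–Plemelj formula for a Hölder continuous density. -/
theorem exists_tendsto_cauchyTransform (hL : 0 ≤ L) (hr : 0 < r) (hc : ContinuousOn h (Ioo A B))
    (hi : IntegrableOn h (Ioo A B))
    (hH : ∀ s ∈ Ioo A B, ∀ s' ∈ Ioo A B, ‖h s - h s'‖ ≤ L * |s - s'| ^ r) {s₀ : ℝ}
    (hs₀ : s₀ ∈ Ioo A B) :
    ∃ p q, Tendsto (cauchyTransform A B h) (𝓝[{z | 0 < z.im}] (s₀ : ℂ)) (𝓝 p) ∧
      Tendsto (cauchyTransform A B h) (𝓝[{z | z.im < 0}] (s₀ : ℂ)) (𝓝 q) ∧ p - q = h s₀ := by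
  have hAB : A < B := hs₀.1.trans hs₀.2
  have hJ := tendsto_reducedIntegral hL hr hc hH hs₀
  have hhr : Tendsto (fun z : ℂ => h z.re) (𝓝 (s₀ : ℂ)) (𝓝 (h s₀)) := by
    refine (hc.continuousAt (isOpen_Ioo.mem_nhds hs₀)).tendsto.comp ?_
    simpa using continuous_re.tendsto (s₀ : ℂ)
  have hlB : Tendsto (fun z : ℂ => log (B - z)) (𝓝 (s₀ : ℂ)) (𝓝 (log (B - s₀))) := by
    have : (B : ℂ) - s₀ ∈ slitPlane := Or.inl (by simpa using hs₀.2)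
    exact (continuousAt_clog this).tendsto.comp
      ((continuous_const.sub continuous_id).tendsto (s₀ : ℂ))
  have hA : Tendsto (fun z : ℂ => (A : ℂ) - z) (𝓝 (s₀ : ℂ)) (𝓝 ((A : ℂ) - s₀)) :=
    (continuous_const.sub continuous_id).tendsto (s₀ : ℂ)
  have hAre : ((A : ℂ) - s₀).re < 0 := by simpa using hs₀.1
  have hAim : ((A : ℂ) - s₀).im = 0 := by simp
  -- For `z` in the upper half plane `A - z` approaches the negative axis from below, so the
  -- argument tends to `-π`; from the other side it tends to `π`. The difference `2πi` produces the
  -- jump `h s₀`.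
  have hlA1 : Tendsto (fun z : ℂ => log (A - z)) (𝓝[{z | 0 < z.im}] (s₀ : ℂ))
      (𝓝 (Real.log ‖(A : ℂ) - s₀‖ - π * I)) := by
    refine (tendsto_log_nhdsWithin_im_neg_of_re_neg_of_im_zero hAre hAim).comp
      (tendsto_nhdsWithin_iff.2 ⟨hA.mono_left nhdsWithin_le_nhds, ?_⟩)
    filter_upwards [self_mem_nhdsWithin] with z hz
    simpa using hz
  have hlA2 : Tendsto (fun z : ℂ => log (A - z)) (𝓝[{z | z.im < 0}] (s₀ : ℂ))
      (𝓝 (Real.log ‖(A : ℂ) - s₀‖ + π * I)) := by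
    refine (tendsto_log_nhdsWithin_im_nonneg_of_re_neg_of_im_zero hAre hAim).comp
      (tendsto_nhdsWithin_iff.2 ⟨hA.mono_left nhdsWithin_le_nhds, ?_⟩)
    filter_upwards [self_mem_nhdsWithin] with z hz
    have : z.im < 0 := hz
    simpa using this.le
  have build : ∀ {U : Set ℂ} {l : ℂ}, U ⊆ {z : ℂ | z.im ≠ 0} →
      Tendsto (fun z : ℂ => log (A - z)) (𝓝[U] (s₀ : ℂ)) (𝓝 l) →
      Tendsto (cauchyTransform A B h) (𝓝[U] (s₀ : ℂ)) (𝓝 ((2 * π * I)⁻¹ *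
        (reducedIntegral A B h s₀ + h s₀ * (log (B - s₀) - l)))) := by
    intro U l hU hl
    refine Tendsto.congr' ?_ ((((hJ.mono_left nhdsWithin_le_nhds).add
      ((hhr.mono_left nhdsWithin_le_nhds).mul
        ((hlB.mono_left nhdsWithin_le_nhds).sub hl)))).const_mul (2 * π * I)⁻¹)
    filter_upwards [self_mem_nhdsWithin] with z hz
    exact (cauchyTransform_eq_reducedIntegral hAB hi (hU hz)).symm
  refine ⟨_, _, build upper_subset hlA1, build lower_subset hlA2, ?_⟩
  have hpi : (π : ℂ) ≠ 0 := ofReal_ne_zero.2 Real.pi_ne_zero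
  have hI := I_ne_zero
  field_simp
  ring

theorem norm_ofReal_sub_le {A s : ℝ} {z : ℂ} (h : |A - z.re| ≤ |s - z.re|) :
    ‖(A : ℂ) - z‖ ≤ ‖(s : ℂ) - z‖ := by
  have h2 := sq_le_sq.2 h
  rw [← sq_le_sq₀ (norm_nonneg _) (norm_nonneg _), Complex.sq_norm, Complex.sq_norm,
    normSq_apply, normSq_apply]
  simp only [sub_re, ofReal_re, sub_im, ofReal_im]
  nlinarith

theorem norm_log_le (z : ℂ) : ‖log z‖ ≤ |Real.log ‖z‖| + π := by
  have h := norm_le_abs_re_add_abs_im (log z)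
  rw [log_re, log_im] at h
  linarith [abs_arg_le_pi z]

theorem posLog_one_div_le (x : ℝ) : Real.posLog (1 / x) ≤ |Real.log x| := by
  rw [one_div, Real.posLog_apply, Real.log_inv]
  exact max_le (abs_nonneg _) (neg_le_abs _)

/-- Near its cut, the Cauchy transform of a Hölder continuous density grows at most like the
logarithm of the distance to the endpoints. -/
theorem exists_norm_cauchyTransform_le (hL : 0 ≤ L) (hr : 0 < r) (hAB : A < B)
    (hi : IntegrableOn h (Ioo A B)) (hK : ∀ s ∈ Ioo A B, ‖h s‖ ≤ K)
    (hH : ∀ s ∈ Ioo A B, ∀ s' ∈ Ioo A B, ‖h s - h s'‖ ≤ L * |s - s'| ^ r) :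
    ∃ Q : ℝ, 0 ≤ Q ∧ ∀ z ∉ segment A B, ‖cauchyTransform A B h z‖ ≤
      Q * (1 + |Real.log ‖(A : ℂ) - z‖| + |Real.log ‖(B : ℂ) - z‖|) := by
  have hK0 : 0 ≤ K := by
    have hm : (A + B) / 2 ∈ Ioo A B := ⟨by linarith, by linarith⟩
    exact (norm_nonneg _).trans (hK _ hm)
  set J := ∫ u, (Ioo (-(B - A)) (B - A)).indicator (fun u => L * |u| ^ (r - 1)) u with hJ
  have hJ0 : 0 ≤ J := integral_nonneg fun u => indicator_nonneg (fun u _ => by positivity) u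
  set E := 1 + Real.posLog (B - A) with hE
  have hE0 : 0 ≤ E := by have := Real.posLog_nonneg (x := B - A); positivity
  have hpi := Real.pi_pos
  refine ⟨J + K * (1 + 2 * π) + K * E, by positivity, fun z hz => ?_⟩
  have hlA := abs_nonneg (Real.log ‖(A : ℂ) - z‖)
  have hlB := abs_nonneg (Real.log ‖(B : ℂ) - z‖)
  -- Over the interval the splitting with logarithms applies. Elsewhere the endpoint nearest to `z`
  -- is the nearest point of the cut, and the bound for merely bounded densities is enough.
  by_cases hzr : z.re ∈ Ioo A B
  · have him : z.im ≠ 0 := fun h => hz (mem_segment_of_im h (Ioo_subset_Icc_self hzr))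
    have h1 : ‖reducedIntegral A B h z‖ ≤ J := norm_reducedIntegral_le hL hr hAB hH hzr
    have h2 : ‖log (B - z) - log (A - z)‖ ≤
        |Real.log ‖(A : ℂ) - z‖| + |Real.log ‖(B : ℂ) - z‖| + 2 * π := by
      refine (norm_sub_le _ _).trans ?_
      linarith [norm_log_le (A - z), norm_log_le (B - z)]
    have h3 : ‖(2 * π * I : ℂ)⁻¹‖ ≤ 1 := by
      have : ‖(2 * π * I : ℂ)⁻¹‖ = (2 * π)⁻¹ := by simp [abs_of_pos Real.pi_pos]
      rw [this]
      exact inv_le_one_of_one_le₀ (by linarith [Real.pi_gt_three])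
    rw [cauchyTransform_eq_reducedIntegral hAB hi him, norm_mul]
    calc _ ≤ 1 * (J + K * (|Real.log ‖(A : ℂ) - z‖| + |Real.log ‖(B : ℂ) - z‖| + 2 * π)) := by
          gcongr
          refine (norm_add_le _ _).trans (add_le_add h1 ?_)
          rw [norm_mul]
          exact mul_le_mul (hK _ hzr) h2 (norm_nonneg _) hK0
      _ ≤ _ := by
          have e1 := mul_nonneg hJ0 (add_nonneg hlA hlB)
          have e2 := mul_nonneg (mul_nonneg hK0 hpi.le) (add_nonneg hlA hlB)
          have e3 := mul_nonneg (mul_nonneg hK0 hE0) (add_nonneg hlA hlB)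
          have e4 := mul_nonneg hK0 hE0
          nlinarith
  · have hne : ∀ s ∈ Icc A B, 0 < ‖(s : ℂ) - z‖ := fun s hs =>
      norm_pos_iff.2 (ofReal_sub_ne_zero_of_notMem hz hs)
    have main : ∀ s₁ ∈ Icc A B, (∀ s ∈ Ioo A B, |s₁ - z.re| ≤ |s - z.re|) →
        ‖cauchyTransform A B h z‖ ≤ K * (E * (1 + |Real.log ‖(s₁ : ℂ) - z‖|)) := by
      intro s₁ hs₁ hs
      refine (norm_cauchyTransform_le_log hAB hK0 hK (hne s₁ hs₁)
        fun s h => norm_ofReal_sub_le (hs s h)).trans ?_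
      gcongr
      exact posLog_one_div_le _
    have e1 := mul_nonneg (mul_nonneg hK0 hE0) hlA
    have e2 := mul_nonneg (mul_nonneg hK0 hE0) hlB
    have e3 : 0 ≤ (J + K * (1 + 2 * π)) *
      (1 + |Real.log ‖(A : ℂ) - z‖| + |Real.log ‖(B : ℂ) - z‖|) := by positivity
    rcases le_or_gt z.re A with hA | hA
    · have := main A (left_mem_Icc.2 hAB.le) fun s hs => by
        rw [abs_of_nonneg (by linarith), abs_of_nonneg (by linarith [hs.1])]
        linarith [hs.1]
      nlinarith
    · have hB : B ≤ z.re := not_lt.1 fun h => hzr ⟨hA, h⟩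
      have := main B (right_mem_Icc.2 hAB.le) fun s hs => by
        rw [abs_of_nonpos (by linarith), abs_of_nonpos (by linarith [hs.2])]
        linarith [hs.2]
      nlinarith

theorem tendsto_norm_mul_log {e e' : ℂ} (hee : e ≠ e') (Q : ℝ) :
    Tendsto (fun z : ℂ => ‖z - e‖ * (Q * (1 + |Real.log ‖e - z‖| + |Real.log ‖e' - z‖|)))
      (𝓝 e) (𝓝 0) := by
  have h1 : Tendsto (fun z : ℂ => ‖z - e‖) (𝓝 e) (𝓝 0) := by
    have : Continuous fun z : ℂ => ‖z - e‖ := by fun_prop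
    simpa using this.tendsto e
  have h2 : Tendsto (fun z : ℂ => |‖z - e‖ * Real.log ‖z - e‖|) (𝓝 e) (𝓝 0) := by
    have := (Real.continuous_mul_log.abs.tendsto 0).comp h1
    simpa [Function.comp_def] using this
  have h3 : Tendsto (fun z : ℂ => |Real.log ‖e' - z‖|) (𝓝 e) (𝓝 |Real.log ‖e' - e‖|) := by
    refine Tendsto.abs (Tendsto.log ?_ (norm_ne_zero_iff.2 (sub_ne_zero.2 hee.symm)))
    have : Continuous fun z : ℂ => ‖e' - z‖ := by fun_prop
    exact this.tendsto e
  have h4 := ((h1.add h2).add (h1.mul h3)).const_mul Q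
  simp only [zero_mul, add_zero, mul_zero] at h4
  refine h4.congr fun z => ?_
  rw [abs_mul, abs_norm, norm_sub_rev e z]
  ring

/-- The singularities of the Cauchy transform at the endpoints are weaker than poles. -/
theorem tendsto_mul_cauchyTransform_endpoint (hL : 0 ≤ L) (hr : 0 < r) (hAB : A < B)
    (hi : IntegrableOn h (Ioo A B)) (hK : ∀ s ∈ Ioo A B, ‖h s‖ ≤ K)
    (hH : ∀ s ∈ Ioo A B, ∀ s' ∈ Ioo A B, ‖h s - h s'‖ ≤ L * |s - s'| ^ r) {e : ℝ}
    (he : e = A ∨ e = B) :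
    Tendsto (fun z => (z - e) * cauchyTransform A B h z) (𝓝[(segment A B)ᶜ] (e : ℂ)) (𝓝 0) := by
  obtain ⟨Q, -, hbd⟩ := exists_norm_cauchyTransform_le hL hr hAB hi hK hH
  have hne : (A : ℂ) ≠ B := fun h => hAB.ne (ofReal_injective h)
  rcases he with rfl | rfl
  · refine squeeze_zero_norm' ?_ ((tendsto_norm_mul_log hne Q).mono_left nhdsWithin_le_nhds)
    filter_upwards [self_mem_nhdsWithin] with z hz
    rw [norm_mul]
    gcongr
    exact hbd z hz
  · refine squeeze_zero_norm' ?_ ((tendsto_norm_mul_log hne.symm Q).mono_left nhdsWithin_le_nhds)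
    filter_upwards [self_mem_nhdsWithin] with z hz
    rw [norm_mul]
    gcongr
    refine (hbd z hz).trans (le_of_eq ?_)
    ring

end Holder

/-! ### Solving the coupled equations by contraction -/

section FixedPoint

variable {a b ε : ℝ} {c d : ℝ → ℂ}

theorem integrableOn_mul_continuous {A B : ℝ} (hc : ContinuousOn c (Ioo A B))
    (hcε : ∀ s ∈ Ioo A B, ‖c s‖ ≤ ε) {g : ℝ → ℂ} (hg : Continuous g) :
    IntegrableOn (fun s => c s * g s) (Ioo A B) := by
  obtain ⟨Q, hQ⟩ := isCompact_Icc (a := A) (b := B).exists_bound_of_continuousOn hg.continuousOn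
  refine IntegrableOn.of_bound (by simp)
    ((hc.mul hg.continuousOn).aestronglyMeasurable measurableSet_Ioo) (ε * Q) ?_
  filter_upwards [ae_restrict_mem measurableSet_Ioo] with s hs
  rw [norm_mul]
  exact mul_le_mul (hcε s hs) (hQ s (Ioo_subset_Icc_self hs)) (norm_nonneg _)
    ((norm_nonneg _).trans (hcε s hs))

/-- The contraction estimate for one component of the fixed point map. `IccExtend` only makes the
unknown a function on the line; its values outside the segment never enter. -/
theorem norm_cauchyTransform_sub_le {A B A' B' : ℝ} (hAB : A < B) (ha : 0 < a)
    (hε : ε * (B - A) ≤ 2 * π * a) (hc : ContinuousOn c (Ioo A B))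
    (hcε : ∀ s ∈ Ioo A B, ‖c s‖ ≤ ε)
    (hdist : ∀ s ∈ Icc A B, ∀ u ∈ Icc A' B', 2 * a ≤ ‖(s : ℂ) - (u : ℝ)‖)
    (φ ψ : C(Icc A B, ℂ)) (u : ℝ) (hu : u ∈ Icc A' B') :
    ‖cauchyTransform A B (fun s => c s * IccExtend hAB.le φ s) u -
      cauchyTransform A B (fun s => c s * IccExtend hAB.le ψ s) u‖ ≤ dist φ ψ / 2 := by
  have hnot : (u : ℂ) ∉ segment A B := by
    rintro ⟨s, hs, h⟩
    have := hdist s hs u hu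
    simp only at h
    rw [h, sub_self, norm_zero] at this
    linarith
  rw [← cauchyTransform_sub hAB
    (integrableOn_mul_continuous hc hcε (φ.continuous.Icc_extend' (h := hAB.le)))
    (integrableOn_mul_continuous hc hcε (ψ.continuous.Icc_extend' (h := hAB.le))) hnot]
  simp_rw [← mul_sub]
  have hm : (A + B) / 2 ∈ Ioo A B := ⟨by linarith, by linarith⟩
  have hε0 : 0 ≤ ε := (norm_nonneg _).trans (hcε _ hm)
  refine (norm_cauchyTransform_le_of_dist hAB (by linarith : 0 < 2 * a) (K := ε * dist φ ψ)
    ?_ ?_).trans (mul_div_two_pi_le ha hε dist_nonneg)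
  · intro s hs
    rw [norm_mul]
    refine mul_le_mul (hcε s hs) ?_ (norm_nonneg _) hε0
    rw [← dist_eq_norm]
    exact ContinuousMap.dist_apply_le_dist (f := φ) (g := ψ) _
  · exact fun s hs => hdist s (Ioo_subset_Icc_self hs) u hu

/-- For small jumps the coupled integral equations are solvable. -/
theorem exists_isCoupledPair_of_small (ha : 0 < a) (hab : a < b) (hε : ε * (b - a) ≤ 2 * π * a)
    (hc : ContinuousOn c (Ioo a b)) (hd : ContinuousOn d (Ioo (-b) (-a)))
    (hcε : ∀ s ∈ Ioo a b, ‖c s‖ ≤ ε) (hdε : ∀ s ∈ Ioo (-b) (-a), ‖d s‖ ≤ ε) (δ δ' : ℂ) :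
    ∃ F G, IsCoupledPair a b c d δ δ' F G := by
  have hnab : -b < -a := neg_lt_neg hab
  have hdisj := disjoint_segments (b := b) ha
  have hint1 := fun ψ : C(Icc a b, ℂ) =>
    integrableOn_mul_continuous hc hcε (ψ.continuous.Icc_extend' (h := hab.le))
  have hint2 := fun φ : C(Icc (-b) (-a), ℂ) =>
    integrableOn_mul_continuous hd hdε (φ.continuous.Icc_extend' (h := hnab.le))
  have hcont1 : ∀ ψ : C(Icc a b, ℂ), Continuous fun u : Icc (-b) (-a) =>
      δ + cauchyTransform a b (fun s => c s * IccExtend hab.le ψ s) ((u : ℝ) : ℂ) := fun ψ =>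
    continuous_const.add
      ((differentiableOn_cauchyTransform hab (hint1 ψ)).continuousOn.comp_continuous
      (continuous_ofReal.comp continuous_subtype_val)
      fun u h => disjoint_left.1 hdisj (ofReal_mem_segment.2 u.2) h)
  have hcont2 : ∀ φ : C(Icc (-b) (-a), ℂ), Continuous fun v : Icc a b =>
      δ' + cauchyTransform (-b) (-a) (fun s => d s * IccExtend hnab.le φ s) ((v : ℝ) : ℂ) :=
    fun φ => continuous_const.add
      ((differentiableOn_cauchyTransform hnab (hint2 φ)).continuousOn.comp_continuous
      (continuous_ofReal.comp continuous_subtype_val)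
      fun v h => disjoint_left.1 hdisj h (ofReal_mem_segment.2 v.2))
  -- The unknowns are the restrictions of `F` and `G` to the opposite cuts, which form a complete
  -- space in the sup metric and determine both densities.
  let T : C(Icc (-b) (-a), ℂ) × C(Icc a b, ℂ) → C(Icc (-b) (-a), ℂ) × C(Icc a b, ℂ) :=
    fun p => (⟨_, hcont1 p.2⟩, ⟨_, hcont2 p.1⟩)
  have hT : ContractingWith (1 / 2) T := by
    refine ⟨by norm_num, LipschitzWith.of_dist_le_mul fun p q => ?_⟩
    have h1 : dist p.1 q.1 ≤ dist p q := le_max_left _ _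
    have h2 : dist p.2 q.2 ≤ dist p q := le_max_right _ _
    have hcoe : (((1 / 2 : NNReal) : ℝ)) * dist p q = dist p q / 2 := by
      push_cast; ring
    rw [hcoe]
    refine max_le ?_ ?_
    · refine (ContinuousMap.dist_le (by positivity)).2 fun u => ?_
      simp only [T, ContinuousMap.coe_mk, dist_add_left]
      rw [dist_eq_norm]
      refine (norm_cauchyTransform_sub_le hab ha hε hc hcε
        (fun s hs u hu => two_mul_le_norm_sub s u hs hu) p.2 q.2 u u.2).trans (by linarith)
    · refine (ContinuousMap.dist_le (by positivity)).2 fun v => ?_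
      simp only [T, ContinuousMap.coe_mk, dist_add_left]
      rw [dist_eq_norm]
      refine (norm_cauchyTransform_sub_le hnab ha (by rwa [neg_sub_neg]) hd hdε
        (fun s hs u hu => ?_) p.1 q.1 v v.2).trans (by linarith)
      rw [norm_sub_rev]
      exact two_mul_le_norm_sub u s hu hs
  obtain ⟨⟨φ, ψ⟩, hfix, -⟩ := hT.exists_fixedPoint (0, 0) (edist_ne_top _ _)
  have hφ : ∀ s (hs : s ∈ Icc (-b) (-a)), φ ⟨s, hs⟩ =
      δ + cauchyTransform a b (fun s => c s * IccExtend hab.le ψ s) s := fun s hs =>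
    (DFunLike.congr_fun (congrArg Prod.fst hfix) (⟨s, hs⟩ : Icc (-b) (-a))).symm
  have hψ : ∀ s (hs : s ∈ Icc a b), ψ ⟨s, hs⟩ =
      δ' + cauchyTransform (-b) (-a) (fun s => d s * IccExtend hnab.le φ s) s := fun s hs =>
    (DFunLike.congr_fun (congrArg Prod.snd hfix) (⟨s, hs⟩ : Icc a b)).symm
  have e1 : EqOn (fun s => c s * IccExtend hab.le ψ s) (fun s : ℝ => c s *
      (δ' + cauchyTransform (-b) (-a) (fun s => d s * IccExtend hnab.le φ s) s)) (Ioo a b) := by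
    intro s hs
    simp only
    rw [IccExtend_of_mem _ _ (Ioo_subset_Icc_self hs), hψ]
  have e2 : EqOn (fun s => d s * IccExtend hnab.le φ s) (fun s : ℝ => d s *
      (δ + cauchyTransform a b (fun s => c s * IccExtend hab.le ψ s) s)) (Ioo (-b) (-a)) := by
    intro s hs
    simp only
    rw [IccExtend_of_mem _ _ (Ioo_subset_Icc_self hs), hφ]
  -- The integral equations themselves extend the fixed point from the segments to the plane.
  refine ⟨fun z => δ + cauchyTransform a b (fun s => c s * IccExtend hab.le ψ s) z,
    fun z => δ' + cauchyTransform (-b) (-a) (fun s => d s * IccExtend hnab.le φ s) z,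
    (differentiableOn_cauchyTransform hab (hint1 ψ)).const_add δ,
    (differentiableOn_cauchyTransform hnab (hint2 φ)).const_add δ',
    (hint1 ψ).congr_fun e1 measurableSet_Ioo, (hint2 φ).congr_fun e2 measurableSet_Ioo, ?_, ?_⟩
  · intro z _
    simp only
    rw [cauchyTransform_congr e1]
  · intro z _
    simp only
    rw [cauchyTransform_congr e2]

end FixedPoint

/-! ### Products of Hölder and holomorphic functions -/

section HolderProduct

/-- Allows a Hölder exponent to be lowered on a bounded interval. -/
theorem rpow_le_mul_rpow {x D q r : ℝ} (hx : 0 ≤ x) (hxD : x ≤ D) (hr : 0 < r) (hrq : r ≤ q) :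
    x ^ q ≤ D ^ (q - r) * x ^ r := by
  rcases hx.eq_or_lt with rfl | hx0
  · rw [Real.zero_rpow (hr.trans_le hrq).ne', Real.zero_rpow hr.ne', mul_zero]
  · have : x ^ q = x ^ (q - r) * x ^ r := by rw [← Real.rpow_add hx0, sub_add_cancel]
    rw [this]
    gcongr

theorem convex_segment (A B : ℝ) : Convex ℝ (segment A B) :=
  (convex_Icc A B).linear_image ofRealCLM.toLinearMap

theorem exists_lipschitz_on_segment {A B : ℝ} {U : Set ℂ} (hU : IsOpen U)
    (hsub : segment A B ⊆ U) {W : ℂ → ℂ} (hW : DifferentiableOn ℂ W U) :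
    ∃ Q : ℝ, 0 ≤ Q ∧ (∀ s ∈ Icc A B, ‖W s‖ ≤ Q) ∧
      ∀ s ∈ Icc A B, ∀ s' ∈ Icc A B, ‖W s - W s'‖ ≤ Q * |s - s'| := by
  obtain ⟨Q₁, hQ₁⟩ := (isCompact_segment A B).exists_bound_of_continuousOn
    (hW.continuousOn.mono hsub)
  obtain ⟨Q₂, hQ₂⟩ := (isCompact_segment A B).exists_bound_of_continuousOn
    ((hW.deriv hU).continuousOn.mono hsub)
  refine ⟨max 0 (max Q₁ Q₂), le_max_left _ _, fun s hs => (hQ₁ s (ofReal_mem_segment.2 hs)).trans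
    (le_max_of_le_right (le_max_left _ _)), fun s hs s' hs' => ?_⟩
  have h := (convex_segment A B).norm_image_sub_le_of_norm_deriv_le
    (fun z hz => hW.differentiableAt (hU.mem_nhds (hsub hz)))
    (fun z hz => (hQ₂ z hz).trans (le_max_of_le_right (le_max_right _ _) : Q₂ ≤ max 0 (max Q₁ Q₂)))
    (ofReal_mem_segment.2 hs') (ofReal_mem_segment.2 hs)
  rwa [← ofReal_sub, norm_real, Real.norm_eq_abs] at h

/-- The product of a bounded Hölder function with a holomorphic one is Hölder. -/
theorem exists_holder_mul {A B : ℝ} (hAB : A < B) {R : ℝ → ℝ} {K L r : ℝ} (hL : 0 ≤ L) (hr : 0 < r)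
    (hK : ∀ s ∈ Ioo A B, |R s| ≤ K)
    (hR : ∀ s ∈ Ioo A B, ∀ s' ∈ Ioo A B, |R s - R s'| ≤ L * |s - s'| ^ r)
    {U : Set ℂ} (hU : IsOpen U) (hsub : segment A B ⊆ U) {W : ℂ → ℂ}
    (hW : DifferentiableOn ℂ W U) :
    ∃ L' r' : ℝ, 0 ≤ L' ∧ 0 < r' ∧ ∀ s ∈ Ioo A B, ∀ s' ∈ Ioo A B,
      ‖(R s : ℂ) * W s - R s' * W s'‖ ≤ L' * |s - s'| ^ r' := by
  obtain ⟨Q, hQ0, hQ, hQL⟩ := exists_lipschitz_on_segment hU hsub hW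
  have hK0 : 0 ≤ K := by
    have hm : (A + B) / 2 ∈ Ioo A B := ⟨by linarith, by linarith⟩
    exact (abs_nonneg _).trans (hK _ hm)
  have hD : 0 < B - A := sub_pos.2 hAB
  have hr' : 0 < min r 1 := lt_min hr one_pos
  -- The exponent is the smaller of `r`, from `R`, and 1, from the Lipschitz bound for `W`; the
  -- powers of `B - A` pay for lowering each of them.
  refine ⟨L * (B - A) ^ (r - min r 1) * Q + K * (Q * (B - A) ^ (1 - min r 1)), min r 1,
    by positivity, hr', fun s hs s' hs' => ?_⟩
  have hx : |s - s'| ≤ B - A := by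
    rw [abs_le]; constructor <;> linarith [hs.1, hs.2, hs'.1, hs'.2]
  have e1 := rpow_le_mul_rpow (abs_nonneg _) hx hr' (min_le_left r 1)
  have e2 := rpow_le_mul_rpow (abs_nonneg _) hx hr' (min_le_right r 1)
  rw [Real.rpow_one] at e2
  have e : (R s : ℂ) * W s - R s' * W s' = ((R s - R s' : ℝ) : ℂ) * W s + R s' * (W s - W s') := by
    push_cast; ring
  rw [e]
  refine (norm_add_le _ _).trans ?_
  rw [norm_mul, norm_mul, norm_real, norm_real, Real.norm_eq_abs, Real.norm_eq_abs]
  calc _ ≤ L * ((B - A) ^ (r - min r 1) * |s - s'| ^ min r 1) * Q +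
        K * (Q * ((B - A) ^ (1 - min r 1) * |s - s'| ^ min r 1)) := by
        refine add_le_add (mul_le_mul ((hR s hs s' hs').trans ?_)
          (hQ s (Ioo_subset_Icc_self hs)) (norm_nonneg _) (by positivity))
          (mul_le_mul (hK s' hs') ((hQL s (Ioo_subset_Icc_self hs) s'
            (Ioo_subset_Icc_self hs')).trans ?_) (norm_nonneg _) hK0)
        · gcongr
        · gcongr
    _ = _ := by ring

end HolderProduct

/-! ### Decay of the jump matrix -/

section Jump

variable {a b α β x t K : ℝ} {R : ℝ → ℝ}

/-- The oscillating factor of the jump, as an entire function. -/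
noncomputable def phase (α β x t : ℝ) (z : ℂ) : ℂ :=
  -2 * z * x - 4 * I * α * z ^ 2 * t + 8 * β * z ^ 3 * t

theorem differentiable_phase : Differentiable ℂ (phase α β x t) := by
  unfold phase; fun_prop

theorem jumpMatrix_right (ha : 0 < a) {s : ℝ} (hs : s ∈ Ioo a b) :
    jumpMatrix α β R x t s 1 0 = R s * (I * exp (phase α β x t s)) := by
  have : 0 < s := ha.trans hs.1
  simp only [jumpMatrix, this, if_true, phase]
  simp; ring

theorem jumpMatrix_left (ha : 0 < a) {s : ℝ} (hs : s ∈ Ioo (-b) (-a)) :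
    jumpMatrix α β R x t s 0 1 = R s * (I * exp (-phase α β x t s)) := by
  have : ¬ 0 < s := by linarith [hs.2]
  simp only [jumpMatrix, this, if_false, phase]
  simp only [Matrix.of_apply, Matrix.cons_val', Matrix.cons_val_zero, Matrix.cons_val_one,
    Matrix.cons_val_fin_one]
  rw [mul_assoc, mul_left_comm]
  congr 3
  ring

theorem phase_re (s : ℝ) : (phase α β x t s).re = -2 * s * x + 8 * β * s ^ 3 * t := by
  simp [phase, ← ofReal_pow]

/-- With `ξ = x/t` the left side is `-2ts (ξ - 4βs²)`. Here `s ≥ a`, and `ξ - 4βs² ≥ ξ - 4βb² > 0`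
because `β ≥ 0` and `s ≤ b`. -/
theorem phase_exponent_le (ha : 0 < a) (hβ : 0 ≤ β) (ht : 0 < t)
    (hξ : 4 * β * b ^ 2 < x / t) {s : ℝ} (hs : s ∈ Ioo a b) :
    -2 * s * x + 8 * β * s ^ 3 * t ≤ -2 * t * a * (x / t - 4 * β * b ^ 2) := by
  obtain ⟨ξ, rfl⟩ : ∃ ξ, x = ξ * t := ⟨x / t, by field_simp⟩
  rw [mul_div_cancel_right₀ _ ht.ne'] at hξ ⊢
  have hs0 : 0 < s := ha.trans hs.1
  have h1 : s ^ 2 ≤ b ^ 2 := pow_le_pow_left₀ hs0.le hs.2.le 2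
  have h2 : β * s ^ 2 ≤ β * b ^ 2 := mul_le_mul_of_nonneg_left h1 hβ
  have h3 : a * (ξ - 4 * β * b ^ 2) ≤ s * (ξ - 4 * β * s ^ 2) :=
    mul_le_mul hs.1.le (by linarith) (by linarith) hs0.le
  have h4 := mul_le_mul_of_nonneg_left h3 ht.le
  nlinarith

theorem norm_jumpMatrix_right_le (ha : 0 < a) (hβ : 0 ≤ β) (ht : 0 < t)
    (hξ : 4 * β * b ^ 2 < x / t) (hK : ∀ s ∈ Ioo a b, |R s| ≤ K) {s : ℝ} (hs : s ∈ Ioo a b) :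
    ‖jumpMatrix α β R x t s 1 0‖ ≤ K * Real.exp (-2 * t * a * (x / t - 4 * β * b ^ 2)) := by
  rw [jumpMatrix_right ha hs, norm_mul, norm_mul, norm_I, one_mul, norm_real, norm_exp, phase_re]
  exact mul_le_mul (hK s hs) (Real.exp_le_exp.2 (phase_exponent_le ha hβ ht hξ hs))
    (Real.exp_pos _).le ((abs_nonneg _).trans (hK s hs))

theorem neg_mem_Ioo {s : ℝ} (hs : s ∈ Ioo (-b) (-a)) : -s ∈ Ioo a b :=
  ⟨by linarith [hs.2], by linarith [hs.1]⟩

/-- The real part of the phase is odd in `s` and `R` is even, so the bound at `s` is the one on the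
right cut at `-s`. -/
theorem norm_jumpMatrix_left_le (ha : 0 < a) (hβ : 0 ≤ β) (ht : 0 < t)
    (hξ : 4 * β * b ^ 2 < x / t) (hK : ∀ s ∈ Ioo a b, |R s| ≤ K)
    (hR : ∀ s ∈ Ioo a b, R (-s) = R s) {s : ℝ} (hs : s ∈ Ioo (-b) (-a)) :
    ‖jumpMatrix α β R x t s 0 1‖ ≤ K * Real.exp (-2 * t * a * (x / t - 4 * β * b ^ 2)) := by
  have hs' := neg_mem_Ioo hs
  have hRs : R s = R (-s) := by rw [← hR _ hs', neg_neg]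
  rw [jumpMatrix_left ha hs, norm_mul, norm_mul, norm_I, one_mul, norm_real, norm_exp, neg_re,
    phase_re, hRs]
  refine mul_le_mul (hK _ hs') (Real.exp_le_exp.2 ?_)
    (Real.exp_pos _).le ((abs_nonneg _).trans (hK _ hs'))
  refine le_trans (le_of_eq ?_) (phase_exponent_le ha hβ ht hξ hs')
  ring

theorem continuousOn_jumpMatrix_right (ha : 0 < a) (hR : ContinuousOn R (Ioo a b)) :
    ContinuousOn (fun s => jumpMatrix α β R x t s 1 0) (Ioo a b) := by
  refine ContinuousOn.congr ?_ fun s hs => jumpMatrix_right ha hs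
  refine (continuous_ofReal.comp_continuousOn hR).mul (Continuous.continuousOn ?_)
  exact continuous_const.mul (continuous_exp.comp
    (differentiable_phase.continuous.comp continuous_ofReal))

theorem continuousOn_left_of_even (hR : ContinuousOn R (Ioo a b))
    (hRs : ∀ s ∈ Ioo a b, R (-s) = R s) : ContinuousOn R (Ioo (-b) (-a)) :=
  (hR.comp continuousOn_neg fun _ hs => neg_mem_Ioo hs).congr fun s hs => by
    have := hRs _ (neg_mem_Ioo hs)
    rw [neg_neg] at this
    exact this

theorem continuousOn_jumpMatrix_left (ha : 0 < a) (hR : ContinuousOn R (Ioo (-b) (-a))) :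
    ContinuousOn (fun s => jumpMatrix α β R x t s 0 1) (Ioo (-b) (-a)) := by
  refine ContinuousOn.congr ?_ fun s hs => jumpMatrix_left ha hs
  refine (continuous_ofReal.comp_continuousOn hR).mul (Continuous.continuousOn ?_)
  exact continuous_const.mul (continuous_exp.comp
    (differentiable_phase.continuous.comp continuous_ofReal).neg)

theorem norm_jumpMatrix_sub_one_le (ha : 0 < a) {B : ℝ} (hB : 0 ≤ B)
    (h1 : ∀ s ∈ Ioo a b, ‖jumpMatrix α β R x t s 1 0‖ ≤ B)
    (h2 : ∀ s ∈ Ioo (-b) (-a), ‖jumpMatrix α β R x t s 0 1‖ ≤ B) {s : ℝ}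
    (hs : s ∈ Ioo a b ∪ Ioo (-b) (-a)) (i j : Fin 2) :
    ‖jumpMatrix α β R x t s i j - (1 : Matrix (Fin 2) (Fin 2) ℂ) i j‖ ≤ B := by
  rcases hs with hs | hs
  · have h := h1 s hs
    rw [jumpMatrix_of_mem_right ha hs]
    fin_cases i <;> fin_cases j <;> simpa using by first | exact hB | exact h
  · have h := h2 s hs
    rw [jumpMatrix_of_mem_left ha hs]
    fin_cases i <;> fin_cases j <;> simpa using by first | exact hB | exact h

end Jump

/-! ### From the coupled equations back to the Riemann–Hilbert problem -/

section Existence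

variable {A B : ℝ} {h : ℝ → ℂ} {δ : ℂ} {F : ℂ → ℂ}

theorem tendsto_of_mem {U : Set ℂ} (hU : IsOpen U) (hF : DifferentiableOn ℂ F U) {s : ℂ}
    (hs : s ∈ U) (V : Set ℂ) : Tendsto F (𝓝[V] s) (𝓝 (F s)) :=
  (hF.continuousOn.continuousAt (hU.mem_nhds hs)).tendsto.mono_left nhdsWithin_le_nhds

theorem tendsto_mul_of_mem {U : Set ℂ} (hU : IsOpen U) (hF : DifferentiableOn ℂ F U) {s : ℂ}
    (hs : s ∈ U) (V : Set ℂ) : Tendsto (fun z => (z - s) * F z) (𝓝[V] s) (𝓝 0) := by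
  have h1 : Tendsto (fun z : ℂ => z - s) (𝓝[V] s) (𝓝 0) := by
    have h : Continuous fun z : ℂ => z - s := by fun_prop
    simpa using (h.tendsto s).mono_left (nhdsWithin_le_nhds (s := V))
  simpa using h1.mul (tendsto_of_mem hU hF hs V)

theorem exists_tendsto_of_eq_cauchyTransform {L r : ℝ} (hL : 0 ≤ L) (hr : 0 < r)
    (hc : ContinuousOn h (Ioo A B)) (hi : IntegrableOn h (Ioo A B))
    (hH : ∀ s ∈ Ioo A B, ∀ s' ∈ Ioo A B, ‖h s - h s'‖ ≤ L * |s - s'| ^ r)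
    (hF : EqOn F (fun z => δ + cauchyTransform A B h z) (segment A B)ᶜ) {s : ℝ}
    (hs : s ∈ Ioo A B) :
    ∃ p q, Tendsto F (𝓝[{z | 0 < z.im}] (s : ℂ)) (𝓝 p) ∧
      Tendsto F (𝓝[{z | z.im < 0}] (s : ℂ)) (𝓝 q) ∧ p - q = h s := by
  obtain ⟨p, q, hp, hq, hpq⟩ := exists_tendsto_cauchyTransform hL hr hc hi hH hs
  refine ⟨δ + p, δ + q, (hp.const_add δ).congr' ?_, (hq.const_add δ).congr' ?_, ?_⟩
  · filter_upwards [self_mem_nhdsWithin] with z hz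
    exact (hF (im_ne_subset_compl_segment A B (upper_subset hz))).symm
  · filter_upwards [self_mem_nhdsWithin] with z hz
    exact (hF (im_ne_subset_compl_segment A B (lower_subset hz))).symm
  · rw [add_sub_add_left_eq_sub, hpq]

theorem tendsto_mul_of_eq_cauchyTransform {L r K : ℝ} (hL : 0 ≤ L) (hr : 0 < r) (hAB : A < B)
    (hi : IntegrableOn h (Ioo A B)) (hK : ∀ s ∈ Ioo A B, ‖h s‖ ≤ K)
    (hH : ∀ s ∈ Ioo A B, ∀ s' ∈ Ioo A B, ‖h s - h s'‖ ≤ L * |s - s'| ^ r)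
    (hF : EqOn F (fun z => δ + cauchyTransform A B h z) (segment A B)ᶜ) {e : ℝ}
    (he : e = A ∨ e = B) :
    Tendsto (fun z => (z - e) * F z) (𝓝[(segment A B)ᶜ] (e : ℂ)) (𝓝 0) := by
  have h1 := tendsto_mul_cauchyTransform_endpoint hL hr hAB hi hK hH he
  have h2 : Tendsto (fun z : ℂ => (z - e) * δ) (𝓝[(segment A B)ᶜ] (e : ℂ)) (𝓝 0) :=
    tendsto_mul_of_mem isOpen_univ (differentiableOn_const δ) (mem_univ _) _
  have h3 := h2.add h1
  rw [add_zero] at h3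
  refine h3.congr' ?_
  filter_upwards [self_mem_nhdsWithin] with z hz
  rw [hF hz]; ring

theorem isBigO_of_eq_cauchyTransform (hi : IntegrableOn h (Ioo A B))
    (hF : EqOn F (fun z => δ + cauchyTransform A B h z) (segment A B)ᶜ) :
    (fun z => F z - δ) =O[Bornology.cobounded ℂ] fun z => z⁻¹ := by
  refine (cauchyTransform_isBigO hi).congr' ?_ EventuallyEq.rfl
  have : (segment A B)ᶜ ∈ Bornology.cobounded ℂ :=
    Bornology.isBounded_def.1 (isCompact_segment A B).isBounded
  filter_upwards [this] with z hz
  rw [hF hz]; ring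

variable {a b α β x t K : ℝ} {R : ℝ → ℝ}

theorem tendsto_matrix_of_entries {l : Filter ℂ} {M : ℂ → Matrix (Fin 2) (Fin 2) ℂ}
    {P : Matrix (Fin 2) (Fin 2) ℂ} (h : ∀ i, Tendsto (fun z => M z i 0) l (𝓝 (P i 0)) ∧
      Tendsto (fun z => M z i 1) l (𝓝 (P i 1))) : Tendsto M l (𝓝 P) :=
  tendsto_pi_nhds.2 fun i => tendsto_pi_nhds.2 fun j => by
    fin_cases j
    · exact (h i).1
    · exact (h i).2

/-- Pointwise limits from a region at every point of a set are automatically continuous along that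
set, so continuity of the boundary values costs nothing extra. -/
theorem exists_continuousOn_boundary {M : ℂ → Matrix (Fin 2) (Fin 2) ℂ} {S : Set ℝ} {U : Set ℂ}
    (hU : ∀ s : ℝ, (s : ℂ) ∈ closure U) {P : ℝ → Matrix (Fin 2) (Fin 2) ℂ}
    (h : ∀ s ∈ S, Tendsto M (𝓝[U] (s : ℂ)) (𝓝 (P s))) : ContinuousOn P S := by
  refine continuousOn_pi.2 fun i => continuousOn_pi.2 fun j => ?_
  have hij : ∀ s ∈ S, Tendsto (fun z => M z i j) (𝓝[U] (s : ℂ)) (𝓝 (P s i j)) := fun s hs =>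
    tendsto_pi_nhds.1 (tendsto_pi_nhds.1 (h s hs) i) j
  have hc : ContinuousOn (extendFrom U fun z => M z i j) ((fun s : ℝ => (s : ℂ)) '' S) := by
    refine continuousOn_extendFrom ?_ ?_
    · rintro _ ⟨s, -, rfl⟩; exact hU s
    · rintro _ ⟨s, hs, rfl⟩; exact ⟨_, hij s hs⟩
  refine (hc.comp continuous_ofReal.continuousOn (mapsTo_image _ _)).congr fun s hs => ?_
  exact (extendFrom_eq (hU s) (hij s hs)).symm

/-- Rows solving the coupled integral equations with Hölder densities solve the
Riemann–Hilbert problem. -/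
theorem isSolution_of_isCoupledPair (ha : 0 < a) (hab : a < b) {F G : Fin 2 → ℂ → ℂ}
    {L r : ℝ} (hL : 0 ≤ L) (hr : 0 < r) (hcont : ContinuousOn R (Ioo a b))
    (hcont' : ContinuousOn R (Ioo (-b) (-a)))
    (hK : ∀ s ∈ Ioo a b, |R s| ≤ K) (hK' : ∀ s ∈ Ioo (-b) (-a), |R s| ≤ K)
    (hR : ∀ s ∈ Ioo a b, ∀ s' ∈ Ioo a b, |R s - R s'| ≤ L * |s - s'| ^ r)
    (hR' : ∀ s ∈ Ioo (-b) (-a), ∀ s' ∈ Ioo (-b) (-a), |R s - R s'| ≤ L * |s - s'| ^ r)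
    (hFG : ∀ i, IsCoupledPair a b (fun s => jumpMatrix α β R x t s 1 0)
      (fun s => jumpMatrix α β R x t s 0 1) ((1 : Matrix (Fin 2) (Fin 2) ℂ) i 0)
      ((1 : Matrix (Fin 2) (Fin 2) ℂ) i 1) (F i) (G i)) :
    IsSolution a b α β R x t fun z => Matrix.of fun i j => if j = 0 then F i z else G i z := by
  have hnab : -b < -a := neg_lt_neg hab
  have hdisj := disjoint_segments (b := b) ha
  have hU1 := (isClosed_segment a b).isOpen_compl
  have hU2 := (isClosed_segment (-b) (-a)).isOpen_compl
  have hs1 : segment a b ⊆ (segment (-b) (-a))ᶜ := fun z hz h => disjoint_left.1 hdisj h hz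
  have hs2 : segment (-b) (-a) ⊆ (segment a b)ᶜ := fun z hz h => disjoint_left.1 hdisj hz h
  have hsub1 : (contour a b)ᶜ ⊆ (segment a b)ᶜ :=
    compl_subset_compl.2 (contour_eq a b ▸ subset_union_right)
  have hsub2 : (contour a b)ᶜ ⊆ (segment (-b) (-a))ᶜ :=
    compl_subset_compl.2 (contour_eq a b ▸ subset_union_left)
  have hphase := differentiable_phase (α := α) (β := β) (x := x) (t := t)
  -- The density is `R` times a function holomorphic near the closed segment: the phase is entire
  -- and `G i` has its cut elsewhere.
  have hH1 : ∀ i, ∃ L' r' : ℝ, 0 ≤ L' ∧ 0 < r' ∧ ∀ s ∈ Ioo a b, ∀ s' ∈ Ioo a b,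
      ‖jumpMatrix α β R x t s 1 0 * G i s - jumpMatrix α β R x t s' 1 0 * G i s'‖ ≤
        L' * |s - s'| ^ r' := by
    intro i
    obtain ⟨L', r', hL', hr', h⟩ := exists_holder_mul hab hL hr hK hR hU2 hs1
      (W := fun z => I * exp (phase α β x t z) * G i z)
      (((hphase.cexp.const_mul I).differentiableOn).mul (hFG i).differentiableOn_right)
    refine ⟨L', r', hL', hr', fun s hs s' hs' => ?_⟩
    rw [jumpMatrix_right ha hs, jumpMatrix_right ha hs', mul_assoc (R s : ℂ),
      mul_assoc (R s' : ℂ)]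
    exact h s hs s' hs'
  have hH2 : ∀ i, ∃ L' r' : ℝ, 0 ≤ L' ∧ 0 < r' ∧ ∀ s ∈ Ioo (-b) (-a), ∀ s' ∈ Ioo (-b) (-a),
      ‖jumpMatrix α β R x t s 0 1 * F i s - jumpMatrix α β R x t s' 0 1 * F i s'‖ ≤
        L' * |s - s'| ^ r' := by
    intro i
    obtain ⟨L', r', hL', hr', h⟩ := exists_holder_mul hnab hL hr hK' hR' hU1 hs2
      (W := fun z => I * exp (-phase α β x t z) * F i z)
      (((hphase.neg.cexp.const_mul I).differentiableOn).mul (hFG i).differentiableOn_left)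
    refine ⟨L', r', hL', hr', fun s hs s' hs' => ?_⟩
    rw [jumpMatrix_left ha hs, jumpMatrix_left ha hs', mul_assoc (R s : ℂ),
      mul_assoc (R s' : ℂ)]
    exact h s hs s' hs'
  have hGc : ∀ i, ContinuousOn (fun s : ℝ => G i s) (Icc a b) := fun i =>
    (hFG i).differentiableOn_right.continuousOn.comp continuous_ofReal.continuousOn
      fun s hs => hs1 (ofReal_mem_segment.2 hs)
  have hFc : ∀ i, ContinuousOn (fun s : ℝ => F i s) (Icc (-b) (-a)) := fun i =>
    (hFG i).differentiableOn_left.continuousOn.comp continuous_ofReal.continuousOn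
      fun s hs => hs2 (ofReal_mem_segment.2 hs)
  have hc1 : ∀ i, ContinuousOn (fun s : ℝ => jumpMatrix α β R x t s 1 0 * G i s) (Ioo a b) :=
    fun i => (continuousOn_jumpMatrix_right ha hcont).mul ((hGc i).mono Ioo_subset_Icc_self)
  have hc2 : ∀ i, ContinuousOn (fun s : ℝ => jumpMatrix α β R x t s 0 1 * F i s)
      (Ioo (-b) (-a)) :=
    fun i => (continuousOn_jumpMatrix_left ha hcont').mul ((hFc i).mono Ioo_subset_Icc_self)
  have hb1 : ∀ i, ∃ Q : ℝ, ∀ s ∈ Ioo a b, ‖jumpMatrix α β R x t s 1 0 * G i s‖ ≤ Q := by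
    intro i
    obtain ⟨Q, hQ⟩ := isCompact_Icc.exists_bound_of_continuousOn
      ((continuous_const.mul (hphase.continuous.comp continuous_ofReal).cexp).continuousOn.mul
        (hGc i) : ContinuousOn (fun s : ℝ => I * exp (phase α β x t s) * G i s) (Icc a b))
    refine ⟨K * Q, fun s hs => ?_⟩
    rw [jumpMatrix_right ha hs, mul_assoc (R s : ℂ), norm_mul, norm_real]
    exact mul_le_mul (hK s hs) (hQ s (Ioo_subset_Icc_self hs)) (norm_nonneg _)
      ((abs_nonneg _).trans (hK s hs))
  have hb2 : ∀ i, ∃ Q : ℝ, ∀ s ∈ Ioo (-b) (-a), ‖jumpMatrix α β R x t s 0 1 * F i s‖ ≤ Q := by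
    intro i
    obtain ⟨Q, hQ⟩ := isCompact_Icc.exists_bound_of_continuousOn
      ((continuous_const.mul (hphase.continuous.comp continuous_ofReal).neg.cexp).continuousOn.mul
        (hFc i) : ContinuousOn (fun s : ℝ => I * exp (-phase α β x t s) * F i s) (Icc (-b) (-a)))
    refine ⟨K * Q, fun s hs => ?_⟩
    rw [jumpMatrix_left ha hs, mul_assoc (R s : ℂ), norm_mul, norm_real]
    exact mul_le_mul (hK' s hs) (hQ s (Ioo_subset_Icc_self hs)) (norm_nonneg _)
      ((abs_nonneg _).trans (hK' s hs))
  set M : ℂ → Matrix (Fin 2) (Fin 2) ℂ := fun z =>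
    Matrix.of fun i j => if j = 0 then F i z else G i z with hM
  have hM0 : ∀ i, (fun z => M z i 0) = F i := fun i => by funext z; simp [hM]
  have hM1 : ∀ i, (fun z => M z i 1) = G i := fun i => by funext z; simp [hM]
  have hlim : ∀ s ∈ Ioo a b ∪ Ioo (-b) (-a), ∃ P Q : Matrix (Fin 2) (Fin 2) ℂ,
      Tendsto M (𝓝[{z : ℂ | 0 < z.im}] (s : ℂ)) (𝓝 P) ∧
      Tendsto M (𝓝[{z : ℂ | z.im < 0}] (s : ℂ)) (𝓝 Q) ∧ P = Q * jumpMatrix α β R x t s := by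
    rintro s (hs | hs)
    · have hlimF : ∀ i, ∃ p q, Tendsto (F i) (𝓝[{z | 0 < z.im}] (s : ℂ)) (𝓝 p) ∧
          Tendsto (F i) (𝓝[{z | z.im < 0}] (s : ℂ)) (𝓝 q) ∧
          p - q = jumpMatrix α β R x t s 1 0 * G i s := by
        intro i
        obtain ⟨L', r', hL', hr', hH⟩ := hH1 i
        exact exists_tendsto_of_eq_cauchyTransform hL' hr' (hc1 i) (hFG i).integrableOn_left hH
          (hFG i).eq_left hs
      choose p q hp hq hpq using hlimF
      have hG := fun i V => tendsto_of_mem hU2 (hFG i).differentiableOn_right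
        (hs1 (ofReal_mem_segment.2 (Ioo_subset_Icc_self hs))) V
      refine ⟨Matrix.of fun i j => if j = 0 then p i else G i s,
        Matrix.of fun i j => if j = 0 then q i else G i s,
        tendsto_matrix_of_entries fun i => ?_, tendsto_matrix_of_entries fun i => ?_, ?_⟩
      · rw [hM0, hM1]; exact ⟨by simpa using hp i, by simpa using hG i _⟩
      · rw [hM0, hM1]; exact ⟨by simpa using hq i, by simpa using hG i _⟩
      · rw [jumpMatrix_of_mem_right ha hs]
        ext i j
        have := hpq i
        fin_cases j
        · simp [Matrix.mul_apply, Fin.sum_univ_two]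
          linear_combination this
        · simp [Matrix.mul_apply, Fin.sum_univ_two]
    · have hlimG : ∀ i, ∃ p q, Tendsto (G i) (𝓝[{z | 0 < z.im}] (s : ℂ)) (𝓝 p) ∧
          Tendsto (G i) (𝓝[{z | z.im < 0}] (s : ℂ)) (𝓝 q) ∧
          p - q = jumpMatrix α β R x t s 0 1 * F i s := by
        intro i
        obtain ⟨L', r', hL', hr', hH⟩ := hH2 i
        exact exists_tendsto_of_eq_cauchyTransform hL' hr' (hc2 i) (hFG i).integrableOn_right hH
          (hFG i).eq_right hs
      choose p q hp hq hpq using hlimG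
      have hF := fun i V => tendsto_of_mem hU1 (hFG i).differentiableOn_left
        (hs2 (ofReal_mem_segment.2 (Ioo_subset_Icc_self hs))) V
      refine ⟨Matrix.of fun i j => if j = 0 then F i s else p i,
        Matrix.of fun i j => if j = 0 then F i s else q i,
        tendsto_matrix_of_entries fun i => ?_, tendsto_matrix_of_entries fun i => ?_, ?_⟩
      · rw [hM0, hM1]; exact ⟨by simpa using hF i _, by simpa using hp i⟩
      · rw [hM0, hM1]; exact ⟨by simpa using hF i _, by simpa using hq i⟩
      · rw [jumpMatrix_of_mem_left ha hs]
        ext i j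
        have := hpq i
        fin_cases j
        · simp [Matrix.mul_apply, Fin.sum_univ_two]
        · simp [Matrix.mul_apply, Fin.sum_univ_two]
          linear_combination this
  -- Boundary matrices are chosen for all real `s`; the value 0 off the cuts is arbitrary.
  have hlim' : ∀ s, ∃ P Q : Matrix (Fin 2) (Fin 2) ℂ, s ∈ Ioo a b ∪ Ioo (-b) (-a) →
      Tendsto M (𝓝[{z : ℂ | 0 < z.im}] (s : ℂ)) (𝓝 P) ∧
      Tendsto M (𝓝[{z : ℂ | z.im < 0}] (s : ℂ)) (𝓝 Q) ∧ P = Q * jumpMatrix α β R x t s := by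
    intro s
    by_cases hs : s ∈ Ioo a b ∪ Ioo (-b) (-a)
    · obtain ⟨P, Q, h⟩ := hlim s hs
      exact ⟨P, Q, fun _ => h⟩
    · exact ⟨0, 0, fun h => absurd h hs⟩
  choose P Q hPQ using hlim'
  refine ⟨?_, ⟨P, Q, ?_, ?_, hPQ⟩, ?_, ?_⟩
  · intro i j
    fin_cases j
    · exact (hM0 i) ▸ (hFG i).differentiableOn_left.mono hsub1
    · exact (hM1 i) ▸ (hFG i).differentiableOn_right.mono hsub2
  · exact exists_continuousOn_boundary ofReal_mem_closure_upper fun s hs => (hPQ s hs).1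
  · exact exists_continuousOn_boundary ofReal_mem_closure_lower fun s hs => (hPQ s hs).2.1
  · intro i j
    fin_cases j
    · exact isBigO_of_eq_cauchyTransform (hFG i).integrableOn_left (hFG i).eq_left
    · exact isBigO_of_eq_cauchyTransform (hFG i).integrableOn_right (hFG i).eq_right
  · have hcase : ∀ e ∈ endpoints a b, ∃ e' : ℝ, e = e' ∧
        ((e' = a ∨ e' = b) ∨ (e' = -b ∨ e' = -a)) := by
      rintro e (rfl | rfl | rfl | rfl)
      · exact ⟨a, rfl, by simp⟩
      · exact ⟨b, rfl, by simp⟩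
      · exact ⟨-a, by simp, by simp⟩
      · exact ⟨-b, by simp, by simp⟩
    intro e he
    obtain ⟨e, rfl, hor⟩ := hcase e he
    refine tendsto_matrix_of_entries fun i => ?_
    simp only [hM, Matrix.smul_apply, Matrix.of_apply, if_true, one_ne_zero, if_false,
      smul_eq_mul, Matrix.zero_apply]
    clear he
    -- At an endpoint of one cut the column living on it has the weak singularity of its Cauchy
    -- transform, while the other column is holomorphic there.
    rcases hor with he | he
    · obtain ⟨L', r', hL', hr', hH⟩ := hH1 i
      obtain ⟨Q, hQ⟩ := hb1 i
      have hmem : e ∈ Icc a b := by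
        rcases he with rfl | rfl
        · exact left_mem_Icc.2 hab.le
        · exact right_mem_Icc.2 hab.le
      exact ⟨(tendsto_mul_of_eq_cauchyTransform hL' hr' hab (hFG i).integrableOn_left hQ hH
        (hFG i).eq_left he).mono_left (nhdsWithin_mono _ hsub1),
        tendsto_mul_of_mem hU2 (hFG i).differentiableOn_right
          (hs1 (ofReal_mem_segment.2 hmem)) _⟩
    · obtain ⟨L', r', hL', hr', hH⟩ := hH2 i
      obtain ⟨Q, hQ⟩ := hb2 i
      have hmem : e ∈ Icc (-b) (-a) := by
        rcases he with rfl | rfl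
        · exact left_mem_Icc.2 hnab.le
        · exact right_mem_Icc.2 hnab.le
      exact ⟨tendsto_mul_of_mem hU1 (hFG i).differentiableOn_left
          (hs2 (ofReal_mem_segment.2 hmem)) _,
        (tendsto_mul_of_eq_cauchyTransform hL' hr' hnab (hFG i).integrableOn_right hQ hH
        (hFG i).eq_right he).mono_left (nhdsWithin_mono _ hsub2)⟩

end Existence

/-! ### Consequences of small jumps for solutions -/

variable {a b α β x t ε : ℝ} {R : ℝ → ℝ} {M : ℂ → Matrix (Fin 2) (Fin 2) ℂ}

theorem infDist_contour_pos {z : ℂ} (hab : a < b) (hz : z ∈ (contour a b)ᶜ) :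
    0 < Metric.infDist z (contour a b) := by
  have hcl : IsClosed (contour a b) := by
    rw [contour_eq]
    exact (isClosed_segment _ _).union (isClosed_segment _ _)
  refine (hcl.notMem_iff_infDist_pos ⟨(a : ℂ), ?_⟩).1 hz
  rw [contour_eq]
  exact Or.inr (ofReal_mem_segment.2 (left_mem_Icc.2 hab.le))

theorem infDist_contour_le {s : ℝ} (hs : (s : ℂ) ∈ contour a b) (z : ℂ) :
    Metric.infDist z (contour a b) ≤ ‖(s : ℂ) - z‖ := by
  rw [norm_sub_rev, ← dist_eq_norm]
  exact Metric.infDist_le_dist_of_mem hs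

theorem norm_one_apply_le (i j : Fin 2) : ‖(1 : Matrix (Fin 2) (Fin 2) ℂ) i j‖ ≤ 1 := by
  rw [Matrix.one_apply]
  split_ifs <;> simp

/-- For small jumps, every solution is close to the identity matrix. -/
theorem IsSolution.norm_sub_one_le (ha : 0 < a) (hab : a < b) (hε : ε * (b - a) ≤ 2 * π * a)
    (hc : ContinuousOn (fun s => jumpMatrix α β R x t s 1 0) (Ioo a b))
    (hd : ContinuousOn (fun s => jumpMatrix α β R x t s 0 1) (Ioo (-b) (-a)))
    (hcε : ∀ s ∈ Ioo a b, ‖jumpMatrix α β R x t s 1 0‖ ≤ ε)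
    (hdε : ∀ s ∈ Ioo (-b) (-a), ‖jumpMatrix α β R x t s 0 1‖ ≤ ε)
    (hM : IsSolution a b α β R x t M) {z : ℂ} (hz : z ∈ (contour a b)ᶜ) (i j : Fin 2) :
    ‖M z i j - (1 : Matrix (Fin 2) (Fin 2) ℂ) i j‖ ≤ 2 * ε * ((1 + Real.posLog (b - a)) *
      (1 + Real.posLog (1 / Metric.infDist z (contour a b)))) := by
  obtain ⟨F, G, hFG, hF, hG⟩ := hM.exists_isCoupledPair ha hab hc hd hcε hdε i
  -- With `η = 1` the unknowns are at most 2 on the opposite cuts, so the densities are at most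
  -- `2ε`.
  obtain ⟨bF, bG⟩ := hFG.norm_le ha hab hε hcε hdε (norm_one_apply_le i 0) (norm_one_apply_le i 1)
  have hε0 : 0 ≤ ε := by
    have hm : (a + b) / 2 ∈ Ioo a b := ⟨by linarith, by linarith⟩
    exact (norm_nonneg _).trans (hcε _ hm)
  have hz' := hz
  rw [contour_eq, mem_compl_iff, mem_union, not_or] at hz'
  have hdist := infDist_contour_pos hab hz
  fin_cases j
  · change ‖M z i 0 - (1 : Matrix (Fin 2) (Fin 2) ℂ) i 0‖ ≤ _
    have e := hFG.eq_left hz'.2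
    dsimp only at e
    rw [show M z i 0 = F z from hF hz, e, add_sub_cancel_left]
    refine norm_cauchyTransform_le_log hab (by positivity) (fun s hs => ?_) hdist
      fun s hs => infDist_contour_le ?_ z
    · rw [norm_mul, mul_comm 2 ε]
      exact mul_le_mul (hcε s hs) (by simpa using bG s (Ioo_subset_Icc_self hs))
        (norm_nonneg _) hε0
    · rw [contour_eq]
      exact Or.inr (ofReal_mem_segment.2 (Ioo_subset_Icc_self hs))
  · change ‖M z i 1 - (1 : Matrix (Fin 2) (Fin 2) ℂ) i 1‖ ≤ _
    have e := hFG.eq_right hz'.1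
    dsimp only at e
    rw [show M z i 1 = G z from hG hz, e, add_sub_cancel_left,
      show b - a = -a - -b by ring]
    refine norm_cauchyTransform_le_log (neg_lt_neg hab) (by positivity) (fun s hs => ?_) hdist
      fun s hs => infDist_contour_le ?_ z
    · rw [norm_mul, mul_comm 2 ε]
      exact mul_le_mul (hdε s hs) (by simpa using bF s (Ioo_subset_Icc_self hs))
        (norm_nonneg _) hε0
    · rw [contour_eq]
      exact Or.inl (ofReal_mem_segment.2 (Ioo_subset_Icc_self hs))

/-- For small jumps, every solution has a potential, and it is small. -/
theorem IsSolution.exists_isPotential (ha : 0 < a) (hab : a < b) (hε : ε * (b - a) ≤ 2 * π * a)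
    (hc : ContinuousOn (fun s => jumpMatrix α β R x t s 1 0) (Ioo a b))
    (hd : ContinuousOn (fun s => jumpMatrix α β R x t s 0 1) (Ioo (-b) (-a)))
    (hcε : ∀ s ∈ Ioo a b, ‖jumpMatrix α β R x t s 1 0‖ ≤ ε)
    (hdε : ∀ s ∈ Ioo (-b) (-a), ‖jumpMatrix α β R x t s 0 1‖ ≤ ε)
    (hM : IsSolution a b α β R x t M) :
    ∃ q : ℂ, IsPotential M q ∧ ‖q‖ ≤ 2 * ε * (b - a) := by
  obtain ⟨F, G, hFG, hF, hG⟩ := hM.exists_isCoupledPair ha hab hc hd hcε hdε 0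
  obtain ⟨bF, -⟩ := hFG.norm_le ha hab hε hcε hdε (norm_one_apply_le 0 0) (norm_one_apply_le 0 1)
  have hε0 : 0 ≤ ε := by
    have hm : (a + b) / 2 ∈ Ioo a b := ⟨by linarith, by linarith⟩
    exact (norm_nonneg _).trans (hcε _ hm)
  refine ⟨_, ((tendsto_mul_cauchyTransform hFG.integrableOn_right).const_mul (-2)).congr' ?_, ?_⟩
  · have hbd : (contour a b)ᶜ ∈ Bornology.cobounded ℂ := by
      rw [contour_eq]
      exact Bornology.isBounded_def.1
        ((isCompact_segment _ _).union (isCompact_segment _ _)).isBounded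
    filter_upwards [hbd] with z hz
    have hz' := hz
    rw [contour_eq, mem_compl_iff, mem_union, not_or] at hz'
    have e := hFG.eq_right hz'.1
    dsimp only at e
    -- The constant term of the `(1,2)` entry vanishes, so `z G(z)` has a finite limit.
    rw [Matrix.one_apply_ne (by decide), zero_add] at e
    rw [Matrix.smul_apply, smul_eq_mul, show M z 0 1 = G z from hG hz, e]
  · have h1 : ‖∫ s in Ioo (-b) (-a), jumpMatrix α β R x t s 0 1 * F s‖ ≤
        2 * ε * volume.real (Ioo (-b) (-a)) := by
      refine norm_setIntegral_le_of_norm_le_const (by simp) fun s hs => ?_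
      rw [norm_mul, mul_comm 2 ε]
      exact mul_le_mul (hdε s hs) (by simpa using bF s (Ioo_subset_Icc_self hs))
        (norm_nonneg _) hε0
    rw [Real.volume_real_Ioo_of_le (neg_lt_neg hab).le, neg_sub_neg] at h1
    -- The norm is `1/π`; the cruder bound 1 is enough.
    have h2 : ‖(-2 : ℂ) * -(2 * π * I)⁻¹‖ ≤ 1 := by
      have : ‖(-2 : ℂ) * -(2 * π * I)⁻¹‖ = π⁻¹ := by
        simp only [norm_mul, norm_neg, norm_inv, norm_I, mul_one, norm_real, Real.norm_eq_abs,
          abs_of_pos Real.pi_pos, Complex.norm_ofNat]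
        field_simp
      rw [this]
      exact inv_le_one_of_one_le₀ (by linarith [Real.pi_gt_three])
    rw [← mul_assoc, norm_mul]
    calc _ ≤ 1 * (2 * ε * (b - a)) := by gcongr
      _ = _ := one_mul _

/-- For small jumps, there is at most one solution. -/
theorem IsSolution.eqOn (ha : 0 < a) (hab : a < b) (hε : ε * (b - a) ≤ 2 * π * a)
    (hc : ContinuousOn (fun s => jumpMatrix α β R x t s 1 0) (Ioo a b))
    (hd : ContinuousOn (fun s => jumpMatrix α β R x t s 0 1) (Ioo (-b) (-a)))
    (hcε : ∀ s ∈ Ioo a b, ‖jumpMatrix α β R x t s 1 0‖ ≤ ε)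
    (hdε : ∀ s ∈ Ioo (-b) (-a), ‖jumpMatrix α β R x t s 0 1‖ ≤ ε)
    (hM : IsSolution a b α β R x t M) {M' : ℂ → Matrix (Fin 2) (Fin 2) ℂ}
    (hM' : IsSolution a b α β R x t M') : EqOn M M' (contour a b)ᶜ := by
  intro z hz
  have hz' := hz
  rw [contour_eq, mem_compl_iff, mem_union, not_or] at hz'
  ext i j
  obtain ⟨F, G, hFG, hF, hG⟩ := hM.exists_isCoupledPair ha hab hc hd hcε hdε i
  obtain ⟨F', G', hFG', hF', hG'⟩ := hM'.exists_isCoupledPair ha hab hc hd hcε hdε i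
  obtain ⟨e1, e2⟩ := hFG.eqOn ha hab hFG' hε hcε hdε
  fin_cases j
  · exact (hF hz).trans ((e1 hz'.2).trans (hF' hz).symm)
  · exact (hG hz).trans ((e2 hz'.1).trans (hG' hz).symm)

/-- For small jumps and Hölder continuous `R`, there is a solution. -/
theorem exists_isSolution (ha : 0 < a) (hab : a < b) (hε : ε * (b - a) ≤ 2 * π * a)
    (hcont : ContinuousOn R (Ioo a b)) {K : ℝ} (hK : ∀ s ∈ Ioo a b, |R s| ≤ K)
    (hRs : ∀ s ∈ Ioo a b, R (-s) = R s)
    (hcε : ∀ s ∈ Ioo a b, ‖jumpMatrix α β R x t s 1 0‖ ≤ ε)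
    (hdε : ∀ s ∈ Ioo (-b) (-a), ‖jumpMatrix α β R x t s 0 1‖ ≤ ε)
    {L r : NNReal} (hr : 0 < r) (hR : HolderOnWith L r R (Ioo a b)) :
    ∃ M, IsSolution a b α β R x t M := by
  have hcont' := continuousOn_left_of_even hcont hRs
  have hRs' : ∀ s ∈ Ioo (-b) (-a), R s = R (-s) := fun s hs => by
    rw [← hRs _ (neg_mem_Ioo hs), neg_neg]
  have hex := fun i : Fin 2 => exists_isCoupledPair_of_small ha hab hε
    (continuousOn_jumpMatrix_right (α := α) (β := β) (x := x) (t := t) ha hcont)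
    (continuousOn_jumpMatrix_left (α := α) (β := β) (x := x) (t := t) ha hcont') hcε hdε
    ((1 : Matrix (Fin 2) (Fin 2) ℂ) i 0) ((1 : Matrix (Fin 2) (Fin 2) ℂ) i 1)
  choose F G hFG using hex
  have hH : ∀ s ∈ Ioo a b, ∀ s' ∈ Ioo a b, |R s - R s'| ≤ (L : ℝ) * |s - s'| ^ (r : ℝ) :=
    fun s hs s' hs' => by
      have := hR.dist_le hs hs'
      rwa [Real.dist_eq, Real.dist_eq] at this
  refine ⟨_, isSolution_of_isCoupledPair ha hab L.coe_nonneg (NNReal.coe_pos.2 hr) hcont hcont' hK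
    (fun s hs => ?_) hH (fun s hs s' hs' => ?_) hFG⟩
  · rw [hRs' s hs]; exact hK _ (neg_mem_Ioo hs)
  · rw [hRs' s hs, hRs' s' hs']
    refine (hH _ (neg_mem_Ioo hs) _ (neg_mem_Ioo hs')).trans (le_of_eq ?_)
    rw [neg_sub_neg, abs_sub_comm]

end SolitonGas

/-! ### Choice of the constants and conclusion -/

theorem mainTheorem5 (a b α β : ℝ) (ha : 0 < a) (hab : a < b) (hβ : 0 ≤ β) (R : ℝ → ℝ)
    (hRcont : ContinuousOn R (Ioo a b))
    (hRbdd : ∃ K : ℝ, ∀ s ∈ Ioo a b, |R s| ≤ K)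
    (hRsymm : ∀ s ∈ Ioo a b, R (-s) = R s) :
    ∃ C : ℝ, 0 < C ∧
      (∀ x t : ℝ, 0 < t → 4 * β * b ^ 2 < x / t →
        ∀ s ∈ Ioo a b ∪ Ioo (-b) (-a), ∀ i j,
          ‖SolitonGas.jumpMatrix α β R x t s i j - (1 : Matrix (Fin 2) (Fin 2) ℂ) i j‖
            ≤ C * Real.exp (-2 * t * a * (x / t - 4 * β * b ^ 2))) ∧
      ∀ ξ₀ : ℝ, 4 * β * b ^ 2 < ξ₀ →
        ∃ T : ℝ, 0 < T ∧ ∀ x t : ℝ, T ≤ t → ξ₀ ≤ x / t →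
          ((∃ (L r : NNReal), 0 < r ∧ HolderOnWith L r R (Ioo a b)) →
            ∃ M, SolitonGas.IsSolution a b α β R x t M) ∧
          (∀ M M', SolitonGas.IsSolution a b α β R x t M →
            SolitonGas.IsSolution a b α β R x t M' →
              EqOn M M' (SolitonGas.contour a b)ᶜ) ∧
          (∀ M, SolitonGas.IsSolution a b α β R x t M →
            (∀ z ∈ (SolitonGas.contour a b)ᶜ, ∀ i j,
              ‖M z i j - (1 : Matrix (Fin 2) (Fin 2) ℂ) i j‖
                ≤ C * (1 + Real.posLog (1 / Metric.infDist z (SolitonGas.contour a b)))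
                  * Real.exp (-2 * t * a * (x / t - 4 * β * b ^ 2))) ∧
            ∃ q : ℂ, SolitonGas.IsPotential M q ∧
              ‖q‖ ≤ C * Real.exp (-2 * t * a * (x / t - 4 * β * b ^ 2))) := by
  obtain ⟨K₀, hK₀⟩ := hRbdd
  -- The maximum with 1 keeps `K`, and so `C` and `T`, positive when `R` vanishes.
  set K := max K₀ 1 with hKdef
  have hK : ∀ s ∈ Ioo a b, |R s| ≤ K := fun s hs => (hK₀ s hs).trans (le_max_left _ _)
  have hK0 : 0 < K := one_pos.trans_le (le_max_right _ _)
  have hl : 0 < b - a := sub_pos.2 hab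
  have hlog := Real.posLog_nonneg (x := b - a)
  have hcont' := SolitonGas.continuousOn_left_of_even hRcont hRsymm
  -- The three summands serve the bounds for the jump, for `M - I` and for `q`; `C` is fixed before
  -- `ξ₀`, so that only `T` depends on it.
  set C := K * (1 + 2 * (1 + Real.posLog (b - a)) + 2 * (b - a)) with hC
  have hKC : K ≤ C := le_mul_of_one_le_right hK0.le (by linarith)
  have hlogC : 2 * K * (1 + Real.posLog (b - a)) ≤ C := by
    rw [hC]; nlinarith [mul_pos hK0 hl]
  have hlenC : 2 * K * (b - a) ≤ C := by
    rw [hC]; nlinarith [mul_nonneg hK0.le hlog]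
  refine ⟨C, by positivity, ?_, ?_⟩
  · intro x t ht hξ s hs i j
    refine (SolitonGas.norm_jumpMatrix_sub_one_le ha (by positivity)
      (fun s hs => SolitonGas.norm_jumpMatrix_right_le ha hβ ht hξ hK hs)
      (fun s hs => SolitonGas.norm_jumpMatrix_left_le ha hβ ht hξ hK hRsymm hs) hs i j).trans ?_
    gcongr
  · intro ξ₀ hξ₀
    have hκ : 0 < 2 * a * (ξ₀ - 4 * β * b ^ 2) := by
      have := sub_pos.2 hξ₀
      positivity
    have hpi := Real.pi_pos
    -- For `t ≥ T` the decay exponent `y` satisfies `K (b - a) ≤ 2πa y`. With `y exp(-y) ≤ 1` this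
    -- gives the smallness condition for `ε = K exp(-y)`.
    refine ⟨K * (b - a) / (2 * π * a) / (2 * a * (ξ₀ - 4 * β * b ^ 2)), by positivity, ?_⟩
    intro x t hT hξ
    have ht : 0 < t := lt_of_lt_of_le (by positivity) hT
    have hξ' : 4 * β * b ^ 2 < x / t := hξ₀.trans_le hξ
    set E := Real.exp (-2 * t * a * (x / t - 4 * β * b ^ 2)) with hE
    have hε : K * E * (b - a) ≤ 2 * π * a := by
      rw [div_le_iff₀ hκ, div_le_iff₀ (by positivity)] at hT
      set y := 2 * t * a * (x / t - 4 * β * b ^ 2) with hy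
      have hy1 : t * (2 * a * (ξ₀ - 4 * β * b ^ 2)) ≤ y := by
        have := mul_le_mul_of_nonneg_left (sub_le_sub_right hξ (4 * β * b ^ 2))
          (by positivity : 0 ≤ 2 * t * a)
        rw [hy]; linarith
      have hEy : E = Real.exp (-y) := by rw [hE, hy]; congr 1; ring
      have h1 : y * Real.exp (-y) ≤ 1 := by
        have := Real.add_one_le_exp y
        calc y * Real.exp (-y) ≤ Real.exp y * Real.exp (-y) := by gcongr; linarith
          _ = 1 := by rw [← Real.exp_add, add_neg_cancel, Real.exp_zero]
      have h2 : K * (b - a) ≤ y * (2 * π * a) := hT.trans (by gcongr)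
      have h3 := mul_le_mul_of_nonneg_right h2 (Real.exp_pos (-y)).le
      rw [hEy]
      have h4 := mul_le_mul_of_nonneg_left h1 (by positivity : 0 ≤ 2 * π * a)
      linarith
    have hcε : ∀ s ∈ Ioo a b, ‖SolitonGas.jumpMatrix α β R x t s 1 0‖ ≤ K * E := fun s hs =>
      SolitonGas.norm_jumpMatrix_right_le ha hβ ht hξ' hK hs
    have hdε : ∀ s ∈ Ioo (-b) (-a), ‖SolitonGas.jumpMatrix α β R x t s 0 1‖ ≤ K * E :=
      fun s hs => SolitonGas.norm_jumpMatrix_left_le ha hβ ht hξ' hK hRsymm hs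
    have hc := SolitonGas.continuousOn_jumpMatrix_right (α := α) (β := β) (x := x) (t := t)
      ha hRcont
    have hd := SolitonGas.continuousOn_jumpMatrix_left (α := α) (β := β) (x := x) (t := t)
      ha hcont'
    have hE0 : 0 ≤ E := (Real.exp_pos _).le
    refine ⟨?_, ?_, ?_⟩
    · rintro ⟨L, r, hr, hR⟩
      exact SolitonGas.exists_isSolution ha hab hε hRcont hK hRsymm hcε hdε hr hR
    · intro M M' hM hM'
      exact hM.eqOn ha hab hε hc hd hcε hdε hM'
    · intro M hM
      refine ⟨fun z hz i j => ?_, ?_⟩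
      · refine (hM.norm_sub_one_le ha hab hε hc hd hcε hdε hz i j).trans ?_
        have hp := Real.posLog_nonneg (x := 1 / Metric.infDist z (SolitonGas.contour a b))
        have := mul_le_mul_of_nonneg_right hlogC (mul_nonneg (add_nonneg zero_le_one hp) hE0)
        linarith
      · obtain ⟨q, hq, hqb⟩ := hM.exists_isPotential ha hab hε hc hd hcε hdε
        refine ⟨q, hq, hqb.trans ?_⟩
        have := mul_le_mul_of_nonneg_right hlenC hE0
        linarith
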